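/- **Theorem.** Let $r>1$, $\alpha>1$, $\kappa>0$. Let $u$ be analytic in the annulus $r^{-1}\le|z|\le r$ cut along the real interval $[r^{-1},r]$, and assume that there are constants $u(1),u(e^{2\pi i}),C_3,C_4\in\mathbb C$ (the first two are the one-sided values of $u$ at the two ends of the cut circle) such that, as $t\to0$ in the complex sector $|\operatorname{Im}t|<\kappa\operatorname{Re}t$, $$u(e^{it})=u(1)+C_3t^{\alpha-1}+o(|t|^{\alpha-1}),\qquad u(e^{i(2\pi-t)})=u(e^{2\pi i})+C_4t^{\alpha-1}+o(|t|^{\alpha-1}).$$ Let $K$ be analytic on the unit circle $|z|=1$, with Laurent coefficients $c_k=\frac1{2\pi i}\int_{|z|=1}K(z)z^{-k-1}dz$, and put $$K_n(z)=\tfrac12c_{-n}z^{-n}+\sum_{k=-n+1}^{n-1}c_kz^k+\tfrac12c_nz^n,$$ $$K_n^+(z)=\tfrac12c_nz^n+\sum_{k\ge n+1}c_kz^k,\qquad K_n^-(z)=\sum_{k\le-n-1}c_kz^k+\tfrac12c_{-n}z^{-n},$$ and $z_-^n=z^{-n}$ for $|z|\ge1$, $z_-^n=z^n$ for $|z|<1$.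 Let $$I(Ku)=\int_0^{2\pi}K(e^{it})u(e^{it})\,dt,\qquad T_{2n}(K_nu)=\frac{\pi}{n}\sum_{k=0}^{2n}{}''\,(K_nu)(e^{\pi ik/n}),$$ where $\sum''$ means that the first and last terms are halved and are formed with the values $u(1)$ and $u(e^{2\pi i})$, respectively. Then the integral $I(Ku)$ exists, there is a $\rho\in(1,r]$ such that $K$ is analytic in the closed annulus $\rho^{-1}\le|z|\le\rho$, and for every such $\rho$ (in particular for $\rho=r$ if $K$ is analytic in $r^{-1}\le|z|\le r$), $$T_{2n}(K_nu)-I(Ku)=\mathrm{p.v.}\!\int_{\rho^{-1}}^{\rho}\frac{z_-^nK(z)-z^{-n}K_n^+(z)-z^nK_n^-(z)}{z^n-z^{-n}}\,\bigl(u(1)-u(e^{2\pi i})\bigr)\frac{dz}{iz}+O(n^{-\alpha}),\qquad n\to\infty,$$ where, for every $n\ge1$, the integral along the real interval exists as a Cauchy principal value at $z=1$. -/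

import Mathlib

open Complex Filter Topology Asymptotics MeasureTheory

noncomputable section

namespace ModifiedTrapezoid

/-- The closed annulus `r⁻¹ ≤ |z| ≤ r`. -/
def annulus (r : ℝ) : Set ℂ := {z | r⁻¹ ≤ ‖z‖ ∧ ‖z‖ ≤ r}

/-- The closed annulus `r⁻¹ ≤ |z| ≤ r` cut along the real interval `[r⁻¹, r]`. -/
def cutAnnulus (r : ℝ) : Set ℂ := annulus r \ (Complex.ofReal '' Set.Icc r⁻¹ r)

/-- The open sector `|Im t| < κ Re t` with vertex `0`, symmetric about the positive real axis. -/
def sector (κ : ℝ) : Set ℂ := {t | |t.im| < κ * t.re}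

/-- `I(g) = ∫₀^{2π} g(e^{it}) dt`. -/
def circleInt (g : ℂ → ℂ) : ℂ := ∫ t in (0 : ℝ)..(2 * Real.pi), g (exp (I * t))

/-- The non-periodic trapezoidal rule with `m` subintervals,
`(2π/m) ∑''_{k=0}^m g(e^{2πik/m})`, the first and last term being halved. The function `g` lives on
the circle cut at `1`; its values `g(1)` and `g(e^{2πi})` at the two ends are `g₀` and `g₁`. -/
def trapezoid (m : ℕ) (g : ℂ → ℂ) (g₀ g₁ : ℂ) : ℂ :=
  2 * Real.pi / m *
    (g₀ / 2 + ∑ k ∈ Finset.Ico 1 m, g (exp (2 * Real.pi * I * k / m)) + g₁ / 2)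

/-- The Laurent coefficient `c_k = (1/2πi) ∫_{|z|=1} K(z) z^{-k-1} dz`. -/
def laurentCoeff (K : ℂ → ℂ) (k : ℤ) : ℂ :=
  1 / (2 * Real.pi * I) * ∮ z in C(0, 1), K z * z ^ (-k - 1)

/-- `K_n(z) = ½ c_{-n} z^{-n} + ∑_{k=-n+1}^{n-1} c_k z^k + ½ c_n z^n`. -/
def laurentMid (K : ℂ → ℂ) (n : ℕ) (z : ℂ) : ℂ :=
  1 / 2 * laurentCoeff K (-n) * z ^ (-n : ℤ)
    + ∑ k ∈ Finset.Ioo (-n : ℤ) n, laurentCoeff K k * z ^ k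
    + 1 / 2 * laurentCoeff K n * z ^ n

/-- `K_n^+(z) = ½ c_n z^n + ∑_{k ≥ n+1} c_k z^k`. -/
def laurentPlus (K : ℂ → ℂ) (n : ℕ) (z : ℂ) : ℂ :=
  1 / 2 * laurentCoeff K n * z ^ n
    + ∑' j : ℕ, laurentCoeff K (n + 1 + j) * z ^ (n + 1 + j : ℤ)

/-- `K_n^-(z) = ∑_{k ≤ -n-1} c_k z^k + ½ c_{-n} z^{-n}`. -/
def laurentMinus (K : ℂ → ℂ) (n : ℕ) (z : ℂ) : ℂ :=
  ∑' j : ℕ, laurentCoeff K (-(n + 1 + j)) * z ^ (-(n + 1 + j) : ℤ)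
    + 1 / 2 * laurentCoeff K (-n) * z ^ (-n : ℤ)

/-- `z_-^n`, equal to `z^{-n}` for `|z| ≥ 1` and to `z^n` for `|z| < 1`. -/
def powMinus (n : ℕ) (z : ℂ) : ℂ := if 1 ≤ ‖z‖ then z ^ (-n : ℤ) else z ^ n

/-- `(z_-^n K(z) - z^{-n} K_n^+(z) - z^n K_n^-(z)) / (z^n - z^{-n})`. -/
def correctionKernel (K : ℂ → ℂ) (n : ℕ) (z : ℂ) : ℂ :=
  (powMinus n z * K z - z ^ (-n : ℤ) * laurentPlus K n z - z ^ n * laurentMinus K n z)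
    / (z ^ n - z ^ (-n : ℤ))

/-- `J` is the Cauchy principal value of `∫_a^b F(x) dx` with respect to the point `c`:
the integrals over `[a, c - ε]` and `[c + ε, b]` exist for small `ε > 0`, and their sum tends
to `J` as `ε → 0`. -/
def IsPrincipalValue (F : ℝ → ℂ) (a c b : ℝ) (J : ℂ) : Prop :=
  (∀ᶠ ε in 𝓝[>] (0 : ℝ), IntervalIntegrable F volume a (c - ε) ∧
      IntervalIntegrable F volume (c + ε) b) ∧
    Tendsto (fun ε : ℝ => (∫ x in a..(c - ε), F x) + ∫ x in (c + ε)..b, F x) (𝓝[>] 0) (𝓝 J)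

end ModifiedTrapezoid

end

/-!
On the circle write `u (exp (I * t))` as a linear function of `t` through its two end values plus a
remainder that vanishes like `t ^ (α - 1)` at `0` and at `2π`. Rotating the contour into the two
sectors shows that the Fourier coefficients of the remainder are `O(|m| ^ (-α))`, so the aliasing
formula bounds its trapezoidal error, also after multiplication by `exp (k * t * I)` with `2|k| ≤ m`
and uniformly in such `k`; summing against the geometrically decaying `c_k` costs only a constant.

The trapezoidal error of `t * exp (k * t * I)` is explicit: aliasing turns it into a
partial-fraction series, which is, expanding in powers of `y ^ (-m)`, the integral over `[1, ∞)` of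
`(y ^ k - y ^ (-k)) / (y * (y ^ m - 1))`. Cutting the integral at `ρ` and summing over `k` gives,
up to exponentially small terms, the principal value in the theorem: `x ↦ 1 / x` folds `[ρ⁻¹, 1]`
onto `[1, ρ]` and cancels the pole at `1`.
-/

namespace ModifiedTrapezoid

/-! ### Fourier series on `[0, 2π]` and Laurent series on an annulus -/

theorem fourierCoeffOn_two_pi (g : ℝ → ℂ) (m : ℤ) :
    fourierCoeffOn Real.two_pi_pos g m =
      1 / (2 * Real.pi) * ∫ t in (0 : ℝ)..(2 * Real.pi), exp (-(m * t * I)) * g t := by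
  rw [fourierCoeffOn_eq_integral, real_smul]
  congr 1
  · push_cast
    rw [sub_zero]
  · refine intervalIntegral.integral_congr fun t _ => ?_
    have hpi : (Real.pi : ℂ) ≠ 0 := by exact_mod_cast Real.pi_ne_zero
    simp only [fourier_coe_apply, smul_eq_mul]
    congr 2
    push_cast
    field_simp
    ring

theorem norm_fourierCoeffOn_two_pi_le {g : ℝ → ℂ} {C : ℝ} (hg : ∀ t, ‖g t‖ ≤ C) (m : ℤ) :
    ‖fourierCoeffOn Real.two_pi_pos g m‖ ≤ C := by
  have hpi := Real.two_pi_pos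
  have hint : ‖∫ t in (0 : ℝ)..(2 * Real.pi), exp (-(m * t * I)) * g t‖ ≤
      C * |2 * Real.pi - 0| := by
    refine intervalIntegral.norm_integral_le_of_norm_le_const fun t _ => ?_
    rw [norm_mul, show (-(m * t * I) : ℂ) = ((-(m * t) : ℝ) : ℂ) * I by push_cast; ring,
      norm_exp_ofReal_mul_I, one_mul]
    exact hg t
  have hnorm : ‖(1 / (2 * Real.pi) : ℂ)‖ = 1 / (2 * Real.pi) := by
    rw [norm_div, norm_one, norm_mul, norm_real, Complex.norm_two,
      Real.norm_of_nonneg Real.pi_pos.le]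
  rw [sub_zero, abs_of_pos hpi] at hint
  rwa [fourierCoeffOn_two_pi, norm_mul, hnorm, div_mul_eq_mul_div, one_mul, div_le_iff₀ hpi]

theorem hasSum_fourierCoeffOn_two_pi {g : ℝ → ℂ} (hg : ContinuousOn g (Set.Icc 0 (2 * Real.pi)))
    (hper : g 0 = g (2 * Real.pi)) (hs : Summable (fourierCoeffOn Real.two_pi_pos g)) {t : ℝ}
    (ht : t ∈ Set.Ico 0 (2 * Real.pi)) :
    HasSum (fun m : ℤ => fourierCoeffOn Real.two_pi_pos g m * exp (m * t * I)) (g t) := by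
  have : Fact (0 < 2 * Real.pi) := ⟨Real.two_pi_pos⟩
  let F : C(AddCircle (2 * Real.pi), ℂ) :=
    ⟨AddCircle.liftIco (2 * Real.pi) 0 g, AddCircle.liftIco_zero_continuous hper hg⟩
  have hF : fourierCoeff F = fourierCoeffOn Real.two_pi_pos g := by
    funext m
    change fourierCoeff (AddCircle.liftIco (2 * Real.pi) 0 g) m = _
    rw [fourierCoeff_liftIco_eq]
    congr 1
    exact zero_add _
  have hsum := has_pointwise_sum_fourier_series_of_summable (hF ▸ hs) (t : AddCircle (2 * Real.pi))
  rw [hF, show F (t : AddCircle (2 * Real.pi)) = g t from AddCircle.liftIco_zero_coe_apply ht]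
    at hsum
  convert hsum using 2 with m
  have hpi : (Real.pi : ℂ) ≠ 0 := by exact_mod_cast Real.pi_ne_zero
  rw [smul_eq_mul, fourier_coe_apply]
  congr 2
  push_cast
  field_simp

theorem isCompact_annulus (r : ℝ) : IsCompact (annulus r) := by
  refine Metric.isCompact_of_isClosed_isBounded ?_ ?_
  · exact (isClosed_le continuous_const continuous_norm).inter
      (isClosed_le continuous_norm continuous_const)
  · exact Metric.isBounded_closedBall.subset fun z hz => mem_closedBall_zero_iff.2 hz.2

theorem annulus_mono {r s : ℝ} (hr : 0 < r) (h : r ≤ s) : annulus r ⊆ annulus s :=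
  fun _ hz => ⟨(inv_anti₀ hr h).trans hz.1, hz.2.trans h⟩

theorem annulus_one : annulus 1 = Metric.sphere 0 1 := by
  ext z
  simp only [annulus, inv_one, Set.mem_ofPred_eq, mem_sphere_iff_norm, sub_zero]
  exact ⟨fun h => le_antisymm h.2 h.1, fun h => ⟨h.ge, h.le⟩⟩

theorem ofReal_mem_annulus {r x : ℝ} (hr : 0 ≤ r) (h₁ : r⁻¹ ≤ x) (h₂ : x ≤ r) :
    (x : ℂ) ∈ annulus r := by
  rw [annulus, Set.mem_ofPred_eq, norm_real,
    Real.norm_of_nonneg ((inv_nonneg.2 hr).trans h₁)]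
  exact ⟨h₁, h₂⟩

theorem circleMap_mem_annulus {r s : ℝ} (hr : 0 ≤ r) (h₁ : r⁻¹ ≤ s) (h₂ : s ≤ r) (t : ℝ) :
    circleMap 0 s t ∈ annulus r := by
  rw [annulus, Set.mem_ofPred_eq, norm_circleMap_zero, abs_of_nonneg ((inv_nonneg.2 hr).trans h₁)]
  exact ⟨h₁, h₂⟩

theorem exists_mem_Ico_circleMap_eq (z : ℂ) :
    ∃ t ∈ Set.Ico 0 (2 * Real.pi), circleMap 0 ‖z‖ t = z := by
  obtain ⟨t, ht, h⟩ := (periodic_circleMap 0 ‖z‖).exists_mem_Ico₀ Real.two_pi_pos (arg z)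
  exact ⟨t, ht, by rw [← h, circleMap_zero, norm_mul_exp_arg_mul_I]⟩

theorem exists_mem_annulus_dist_le {r δ : ℝ} (hr : 1 ≤ r) (hδ : 0 ≤ δ) {z : ℂ}
    (hz : z ∈ annulus (r + δ)) : ∃ w ∈ annulus r, dist z w ≤ δ := by
  obtain ⟨t, -, ht⟩ := exists_mem_Ico_circleMap_eq z
  have hr₀ : 0 < r := by linarith
  have hinv : r⁻¹ ≤ r := (inv_le_one_of_one_le₀ hr).trans hr
  have hinvδ : r⁻¹ - (r + δ)⁻¹ ≤ δ := by
    rw [inv_sub_inv hr₀.ne' (by positivity), div_le_iff₀ (by positivity)]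
    nlinarith [mul_le_mul hr hr zero_le_one hr₀.le, mul_nonneg hr₀.le hδ]
  set s := max r⁻¹ (min ‖z‖ r)
  refine ⟨circleMap 0 s t, circleMap_mem_annulus hr₀.le (le_max_left _ _)
    (max_le hinv (min_le_right _ _)) t, ?_⟩
  have hdist : dist z (circleMap 0 s t) = |‖z‖ - s| := by
    conv_lhs => rw [← ht]
    rw [dist_eq, circleMap_zero, circleMap_zero, ← sub_mul, norm_mul, norm_exp_ofReal_mul_I,
      mul_one, ← ofReal_sub, norm_real, Real.norm_eq_abs]
  rw [hdist, abs_le, le_sub_iff_add_le', sub_le_iff_le_add']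
  constructor
  · rw [← sub_eq_add_neg, sub_le_iff_le_add]
    exact max_le (by linarith [hz.1]) (by linarith [min_le_left ‖z‖ r])
  · rcases min_cases ‖z‖ r with h | h <;> linarith [le_max_right r⁻¹ (min ‖z‖ r), hz.2]

theorem exists_annulus_subset {r : ℝ} (hr : 1 ≤ r) {U : Set ℂ} (hU : IsOpen U)
    (h : annulus r ⊆ U) : ∃ s, r < s ∧ annulus s ⊆ U := by
  obtain ⟨δ, hδ, hsub⟩ := (isCompact_annulus r).exists_cthickening_subset_open hU h
  refine ⟨r + δ, by linarith, fun z hz => hsub ?_⟩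
  obtain ⟨w, hw, hzw⟩ := exists_mem_annulus_dist_le hr hδ.le hz
  exact Metric.mem_cthickening_of_dist_le z w δ _ hw hzw

theorem exists_analyticOnNhd_annulus {K : ℂ → ℂ} {r : ℝ} (hr : 1 ≤ r)
    (hK : AnalyticOnNhd ℂ K (annulus r)) : ∃ s, r < s ∧ AnalyticOnNhd ℂ K (annulus s) :=
  exists_annulus_subset hr (isOpen_analyticAt ℂ K) hK

theorem circleIntegral_mul_zpow_eq_of_analyticOnNhd {K : ℂ → ℂ} {r : ℝ} (hr : 0 < r)
    (hK : AnalyticOnNhd ℂ K (annulus r)) (m : ℤ) {a b : ℝ} (ha : r⁻¹ ≤ a) (hab : a ≤ b)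
    (hb : b ≤ r) :
    (∮ z in C(0, b), K z * z ^ m) = ∮ z in C(0, a), K z * z ^ m := by
  have ha₀ : 0 < a := (inv_pos.2 hr).trans_le ha
  have hd : ∀ z ∈ Metric.closedBall (0 : ℂ) b \ Metric.ball 0 a,
      DifferentiableAt ℂ (fun z => K z * z ^ m) z := by
    intro z hz
    simp only [Set.mem_sdiff, Metric.mem_closedBall, dist_zero_right, Metric.mem_ball,
      not_lt] at hz
    exact (hK z ⟨ha.trans hz.2, hz.1.trans hb⟩).differentiableAt.mul
      (differentiableAt_zpow.2 (Or.inl (norm_pos_iff.1 (ha₀.trans_le hz.2))))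
  refine circleIntegral_eq_of_differentiable_on_annulus_off_countable ha₀ hab
    Set.countable_empty (fun z hz => (hd z hz).continuousAt.continuousWithinAt) ?_
  rintro z ⟨⟨hzb, hza⟩, -⟩
  exact hd z ⟨Metric.ball_subset_closedBall hzb, fun h => hza (Metric.ball_subset_closedBall h)⟩

theorem circleIntegral_mul_zpow_eq_fourierCoeffOn (K : ℂ → ℂ) (m : ℤ) {s : ℝ} (hs : s ≠ 0) :
    (1 / (2 * Real.pi * I) * ∮ z in C(0, s), K z * z ^ (-m - 1)) * (s : ℂ) ^ m =
      fourierCoeffOn Real.two_pi_pos (fun t => K (circleMap 0 s t)) m := by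
  have hs' : (s : ℂ) ≠ 0 := by exact_mod_cast hs
  have hpi : (Real.pi : ℂ) ≠ 0 := by exact_mod_cast Real.pi_ne_zero
  rw [fourierCoeffOn_two_pi, circleIntegral, mul_assoc, mul_comm (∫ _ in _.._, _) ((s : ℂ) ^ m),
    ← intervalIntegral.integral_const_mul, ← intervalIntegral.integral_const_mul,
    ← intervalIntegral.integral_const_mul]
  refine intervalIntegral.integral_congr fun t _ => ?_
  have hpow : circleMap 0 s t ^ (-m - 1) = (s : ℂ) ^ (-m) * exp (-(m * t * I)) *
      (circleMap 0 s t)⁻¹ := by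
    rw [zpow_sub_one₀ (circleMap_ne_center hs), circleMap_zero, mul_zpow, ← exp_int_mul]
    congr 3
    push_cast
    ring
  have := zpow_ne_zero m hs'
  have : circleMap 0 s t ≠ 0 := circleMap_ne_center hs
  simp only [deriv_circleMap, smul_eq_mul]
  rw [hpow, zpow_neg]
  field_simp

theorem laurentCoeff_mul_zpow {K : ℂ → ℂ} {r : ℝ} (hr : 1 ≤ r)
    (hK : AnalyticOnNhd ℂ K (annulus r)) (m : ℤ) {s : ℝ} (h₁ : r⁻¹ ≤ s) (h₂ : s ≤ r) :
    laurentCoeff K m * (s : ℂ) ^ m =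
      fourierCoeffOn Real.two_pi_pos (fun t => K (circleMap 0 s t)) m := by
  have hr₀ : 0 < r := by linarith
  rw [← circleIntegral_mul_zpow_eq_fourierCoeffOn K m ((inv_pos.2 hr₀).trans_le h₁).ne',
    laurentCoeff]
  congr 2
  rcases le_total 1 s with h | h
  · exact (circleIntegral_mul_zpow_eq_of_analyticOnNhd hr₀ hK _ (inv_le_one_of_one_le₀ hr) h
      h₂).symm
  · exact circleIntegral_mul_zpow_eq_of_analyticOnNhd hr₀ hK _ h₁ h hr

theorem exists_norm_laurentCoeff_le {K : ℂ → ℂ} {r : ℝ} (hr : 1 ≤ r)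
    (hK : AnalyticOnNhd ℂ K (annulus r)) :
    ∃ M, 0 ≤ M ∧ ∀ m : ℤ, ‖laurentCoeff K m‖ ≤ M * r⁻¹ ^ m.natAbs := by
  have hr₀ : 0 < r := by linarith
  obtain ⟨M, hM⟩ := (isCompact_annulus r).exists_bound_of_continuousOn hK.continuousOn
  have hinv : r⁻¹ ≤ r := (inv_le_one_of_one_le₀ hr).trans hr
  have hcauchy : ∀ s : ℝ, r⁻¹ ≤ s → s ≤ r → ∀ m : ℤ, ‖laurentCoeff K m‖ * s ^ m ≤ M := by
    intro s h₁ h₂ m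
    rw [← Real.norm_of_nonneg ((inv_pos.2 hr₀).trans_le h₁).le, ← norm_real, ← norm_zpow,
      ← norm_mul, laurentCoeff_mul_zpow hr hK m h₁ h₂]
    exact norm_fourierCoeffOn_two_pi_le (fun t => hM _ (circleMap_mem_annulus hr₀.le h₁ h₂ t)) m
  refine ⟨M, (norm_nonneg _).trans (hM _ (ofReal_mem_annulus hr₀.le hinv le_rfl)), fun m => ?_⟩
  rw [inv_pow, ← div_eq_mul_inv, le_div_iff₀ (by positivity)]
  obtain ⟨k, rfl | rfl⟩ := m.eq_nat_or_neg
  · simpa using hcauchy r hinv le_rfl k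
  · simpa using hcauchy r⁻¹ le_rfl hinv (-k)

theorem summable_pow_natAbs {q : ℝ} (h₀ : 0 ≤ q) (h₁ : q < 1) :
    Summable fun m : ℤ => q ^ m.natAbs := by
  refine Summable.of_nat_of_neg ?_ ?_ <;> simpa using summable_geometric_of_lt_one h₀ h₁

theorem zpow_le_pow_natAbs_add_inv_pow_natAbs {x : ℝ} (hx : 0 < x) (m : ℤ) :
    x ^ m ≤ x ^ m.natAbs + x⁻¹ ^ m.natAbs := by
  obtain ⟨k, rfl | rfl⟩ := m.eq_nat_or_neg
  · simpa using pow_nonneg hx.le k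
  · simpa using pow_nonneg hx.le k

theorem summable_laurentCoeff_mul_zpow {K : ℂ → ℂ} {r : ℝ} (hr : 1 ≤ r)
    (hK : AnalyticOnNhd ℂ K (annulus r)) {z : ℂ} (hz₁ : r⁻¹ < ‖z‖) (hz₂ : ‖z‖ < r) :
    Summable fun m : ℤ => ‖laurentCoeff K m * z ^ m‖ := by
  have hr₀ : 0 < r := by linarith
  have hz₀ : 0 < ‖z‖ := (inv_pos.2 hr₀).trans hz₁
  obtain ⟨M, hM₀, hM⟩ := exists_norm_laurentCoeff_le hr hK
  have hpos : Summable fun m : ℤ => (r⁻¹ * ‖z‖) ^ m.natAbs :=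
    summable_pow_natAbs (by positivity) (by rwa [inv_mul_lt_iff₀ hr₀, mul_one])
  have hneg : Summable fun m : ℤ => (r⁻¹ * ‖z‖⁻¹) ^ m.natAbs :=
    summable_pow_natAbs (by positivity)
      (by rwa [← div_eq_mul_inv, div_lt_one hz₀])
  refine Summable.of_nonneg_of_le (fun _ => norm_nonneg _) (fun m => ?_)
    ((hpos.add hneg).mul_left M)
  rw [norm_mul, norm_zpow, mul_pow, mul_pow, ← mul_add, ← mul_assoc]
  exact mul_le_mul (hM m) (zpow_le_pow_natAbs_add_inv_pow_natAbs hz₀ m) (by positivity)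
    (by positivity)

theorem hasSum_laurent {K : ℂ → ℂ} {r : ℝ} (hr : 1 ≤ r)
    (hK : AnalyticOnNhd ℂ K (annulus r)) {z : ℂ} (hz₁ : r⁻¹ < ‖z‖) (hz₂ : ‖z‖ < r) :
    HasSum (fun m : ℤ => laurentCoeff K m * z ^ m) (K z) := by
  have hr₀ : 0 ≤ r := by linarith
  have hcoeff := fun m => laurentCoeff_mul_zpow hr hK m hz₁.le hz₂.le
  have hcont : Continuous fun t : ℝ => K (circleMap 0 ‖z‖ t) :=
    hK.continuousOn.comp_continuous (continuous_circleMap 0 ‖z‖)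
      (circleMap_mem_annulus hr₀ hz₁.le hz₂.le)
  have hsum : Summable (fourierCoeffOn Real.two_pi_pos fun t => K (circleMap 0 ‖z‖ t)) := by
    refine ((summable_laurentCoeff_mul_zpow hr hK hz₁ hz₂).congr fun m => ?_).of_norm
    rw [← hcoeff, norm_mul, norm_mul, norm_zpow, norm_zpow, norm_real, norm_norm]
  obtain ⟨t, ht, hzt⟩ := exists_mem_Ico_circleMap_eq z
  have hfourier := hasSum_fourierCoeffOn_two_pi hcont.continuousOn
    (congrArg K (by simpa using (periodic_circleMap 0 ‖z‖ 0).symm)) hsum ht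
  rw [hzt] at hfourier
  convert hfourier using 2 with m
  rw [← hcoeff m, mul_assoc]
  conv_lhs => rw [← hzt, circleMap_zero, mul_zpow, ← exp_int_mul, ← mul_assoc (m : ℂ)]

/-! ### Oscillatory integrals and rotation of the contour -/

theorem integrableOn_one_add_rpow_mul_exp_neg (β : ℝ) {c : ℝ} (hc : 0 < c) :
    IntegrableOn (fun v : ℝ => (1 + v) ^ β * Real.exp (-(c * v))) (Set.Ioi 0) := by
  refine integrable_of_isBigO_exp_neg (half_pos hc) ?_ ?_
  · refine ContinuousOn.mul (ContinuousOn.rpow_const (by fun_prop) fun v hv => Or.inl ?_)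
      (by fun_prop)
    have : (0 : ℝ) ≤ v := hv
    positivity
  · have hpow : (fun v : ℝ => (1 + v) ^ β) =O[atTop] fun v => Real.exp (c / 2 * (1 + v)) :=
      ((isLittleO_rpow_exp_pos_mul_atTop β (half_pos hc)).comp_tendsto
        (tendsto_const_nhds.add_atTop tendsto_id)).isBigO
    refine (hpow.mul (isBigO_refl (fun v => Real.exp (-(c * v))) atTop)).trans
      (IsBigO.of_bound (Real.exp (c / 2)) (Eventually.of_forall fun v => le_of_eq ?_))
    rw [← Real.exp_add, Real.norm_of_nonneg (Real.exp_nonneg _),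
      Real.norm_of_nonneg (Real.exp_nonneg _), ← Real.exp_add]
    ring_nf

theorem exists_integral_inv_add_rpow_mul_exp_neg_le (α : ℝ) {c : ℝ} (hc : 0 < c) :
    ∃ B, ∀ σ x : ℝ, 0 ≤ σ → 0 < x →
      ∫ s in (0 : ℝ)..σ, (x⁻¹ + s) ^ (α - 1) * Real.exp (-(c * (x * s))) ≤ B * x ^ (-α) := by
  set φ : ℝ → ℝ := fun v => (1 + v) ^ (α - 1) * Real.exp (-(c * v))
  have hφ₀ : ∀ v ∈ Set.Ioi (0 : ℝ), 0 ≤ φ v := fun v hv => by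
    have : (0 : ℝ) < v := hv
    positivity
  refine ⟨∫ v in Set.Ioi (0 : ℝ), φ v, fun σ x hσ hx => ?_⟩
  have hscale : ∀ s ∈ Set.uIcc 0 σ, (x⁻¹ + s) ^ (α - 1) * Real.exp (-(c * (x * s))) =
      x ^ (-(α - 1)) * φ (x * s) := by
    intro s hs
    rw [Set.uIcc_of_le hσ] at hs
    rw [show x⁻¹ + s = x⁻¹ * (1 + x * s) by field_simp,
      Real.mul_rpow (by positivity) (by have := mul_nonneg hx.le hs.1; positivity),
      Real.inv_rpow hx.le, ← Real.rpow_neg hx.le, mul_assoc]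
  have hle : ∫ v in (0 : ℝ)..(x * σ), φ v ≤ ∫ v in Set.Ioi (0 : ℝ), φ v := by
    rw [intervalIntegral.integral_of_le (by positivity)]
    exact setIntegral_mono_set (integrableOn_one_add_rpow_mul_exp_neg _ hc)
      ((ae_restrict_iff' measurableSet_Ioi).2 (ae_of_all _ hφ₀))
      (Eventually.of_forall fun v hv => hv.1)
  rw [intervalIntegral.integral_congr hscale, intervalIntegral.integral_const_mul,
    intervalIntegral.integral_comp_mul_left φ hx.ne', mul_zero, smul_eq_mul, ← mul_assoc,
    ← Real.rpow_neg_one, ← Real.rpow_add hx, show -(α - 1) + -1 = -α by ring, mul_comm]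
  gcongr

theorem norm_exp_neg_mul_mul_I (x y : ℝ) (t : ℂ) :
    ‖exp (-(y * x * t * I))‖ = Real.exp (y * x * t.im) := by
  simp [norm_exp]

theorem integral_segment_eq_sub {G g : ℂ → ℂ} {z v : ℂ} {a b : ℝ}
    (hG : ∀ s ∈ Set.uIcc a b, HasDerivAt G (g (z + s * v)) (z + s * v))
    (hg : ContinuousOn (fun s : ℝ => g (z + s * v)) (Set.uIcc a b)) :
    ∫ s in a..b, g (z + s * v) * v = G (z + b * v) - G (z + a * v) := by
  refine intervalIntegral.integral_eq_sub_of_hasDerivAt (f := fun s : ℝ => G (z + s * v))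
    (fun s hs => ?_) (hg.mul continuousOn_const).intervalIntegrable
  have hline : HasDerivAt (fun s : ℝ => z + (s : ℂ) * v) v s := by
    simpa using (((hasDerivAt_id s).ofReal_comp).mul_const v).const_add z
  exact (hG s hs).comp s hline

theorem exists_integral_segment_eq_sub {g : ℂ → ℂ} {U : Set ℂ} (hU : IsOpen U)
    (hconv : Convex ℝ U) (hg : DifferentiableOn ℂ g U) :
    ∃ G : ℂ → ℂ, ∀ (z v : ℂ) (a b : ℝ), a ≤ b → z + a * v ∈ U → z + b * v ∈ U →
      ∫ s in a..b, g (z + s * v) * v = G (z + b * v) - G (z + a * v) := by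
  obtain ⟨G, hG⟩ := hconv.exists_forall_hasDerivWithinAt hg
  refine ⟨G, fun z v a b hab ha hb => ?_⟩
  have hconv_line : Convex ℝ {s : ℝ | z + s * v ∈ U} := by
    have h := hconv.affine_preimage (AffineMap.lineMap z (z + v) : ℝ →ᵃ[ℝ] ℂ)
    simpa [Set.preimage, AffineMap.lineMap_apply, add_comm] using h
  have hmem : ∀ s ∈ Set.uIcc a b, z + s * v ∈ U := by
    rw [Set.uIcc_of_le hab]
    exact fun s hs => hconv_line.ordConnected.out ha hb hs
  exact integral_segment_eq_sub
    (fun s hs => (hG _ (hmem s hs)).hasDerivAt (hU.mem_nhds (hmem s hs)))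
    (hg.continuousOn.comp (by fun_prop) hmem)

theorem ofReal_mem_sector {κ : ℝ} (hκ : 0 < κ) {t : ℝ} (ht : 0 < t) : (t : ℂ) ∈ sector κ := by
  simp only [sector, Set.mem_ofPred_eq, ofReal_im, abs_zero, ofReal_re]
  positivity

theorem tendsto_ofReal_nhdsWithin_sector {κ : ℝ} (hκ : 0 < κ) :
    Tendsto (fun t : ℝ => (t : ℂ)) (𝓝[>] 0) (𝓝[sector κ] 0) :=
  tendsto_nhdsWithin_iff.2
    ⟨(continuous_ofReal.tendsto' 0 0 ofReal_zero).mono_left nhdsWithin_le_nhds,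
      eventually_mem_nhdsWithin.mono fun _ ht => ofReal_mem_sector hκ ht⟩

theorem isBigO_integral_zero_inv_exp_mul {f : ℝ → ℂ} {α : ℝ} (hα : 1 ≤ α)
    (hf : f =O[𝓝[>] 0] fun t => t ^ (α - 1)) (y : ℝ) :
    (fun x : ℝ => ∫ t in (0 : ℝ)..x⁻¹, exp (-(y * x * t * I)) * f t)
      =O[atTop] fun x => x ^ (-α) := by
  obtain ⟨C, hC₀, hC⟩ := hf.exists_pos
  obtain ⟨δ, hδ, hCδ⟩ := mem_nhdsGT_iff_exists_Ioc_subset.1 hC.bound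
  refine IsBigO.of_bound C ?_
  filter_upwards [eventually_gt_atTop 0, eventually_ge_atTop δ⁻¹] with x hx hxδ
  have hinv : 0 < x⁻¹ := inv_pos.2 hx
  have hbound : ∀ t ∈ Set.uIoc 0 x⁻¹,
      ‖exp (-(y * x * t * I)) * f t‖ ≤ C * x⁻¹ ^ (α - 1) := by
    intro t ht
    rw [Set.uIoc_of_le hinv.le] at ht
    have hft : ‖f t‖ ≤ C * ‖t ^ (α - 1)‖ :=
      hCδ ⟨ht.1, ht.2.trans (inv_le_of_inv_le₀ hδ hxδ)⟩
    rw [Real.norm_of_nonneg (Real.rpow_nonneg ht.1.le _)] at hft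
    rw [norm_mul, norm_exp_neg_mul_mul_I, ofReal_im, mul_zero, Real.exp_zero, one_mul]
    refine hft.trans ?_
    gcongr
    · exact ht.1.le
    · exact ht.2
  refine (intervalIntegral.norm_integral_le_of_norm_le_const hbound).trans (le_of_eq ?_)
  rw [sub_zero, abs_of_pos hinv, mul_assoc, ← Real.rpow_add_one hinv.ne', sub_add_cancel,
    Real.inv_rpow hx.le, ← Real.rpow_neg hx.le, Real.norm_of_nonneg (by positivity)]

theorem norm_exp_mul_apply_slanted_le {f : ℂ → ℂ} {κ α C δ x y s : ℝ} {d : ℂ} (hα : 1 ≤ α)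
    (hC : 0 ≤ C) (hf : ∀ t ∈ sector κ, ‖t‖ < δ → ‖f t‖ ≤ C * ‖t‖ ^ (α - 1)) (hre : d.re = 1)
    (him : |d.im| < κ) (hx : 0 < x) (hs : 0 < s) (hδ : ‖d‖ * (x⁻¹ + s) < δ) :
    ‖exp (-(y * x * ((x⁻¹ : ℝ) + s * d) * I)) * f ((x⁻¹ : ℝ) + s * d) * d‖ ≤
      C * ‖d‖ ^ (α - 1) * ‖d‖ * ((x⁻¹ + s) ^ (α - 1) * Real.exp (-(-(y * d.im) * (x * s)))) := by
  have hinv : 0 < x⁻¹ := inv_pos.2 hx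
  have hd : 1 ≤ ‖d‖ := by simpa [hre] using abs_re_le_norm d
  have hnorm : ‖((x⁻¹ : ℝ) + s * d : ℂ)‖ ≤ ‖d‖ * (x⁻¹ + s) := by
    refine (norm_add_le _ _).trans ?_
    rw [norm_mul, norm_real, norm_real, Real.norm_of_nonneg hinv.le, Real.norm_of_nonneg hs.le]
    nlinarith
  have hsector : ((x⁻¹ : ℝ) + s * d : ℂ) ∈ sector κ := by
    simp only [sector, Set.mem_ofPred_eq, add_im, ofReal_im, im_ofReal_mul, zero_add, add_re,
      ofReal_re, re_ofReal_mul, hre, mul_one, abs_mul, abs_of_pos hs]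
    nlinarith [abs_nonneg d.im]
  have hfz : ‖f ((x⁻¹ : ℝ) + s * d)‖ ≤ C * (‖d‖ ^ (α - 1) * (x⁻¹ + s) ^ (α - 1)) := by
    refine (hf _ hsector (hnorm.trans_lt hδ)).trans ?_
    rw [← Real.mul_rpow (by positivity) (by positivity)]
    gcongr
  have hexp : ‖exp (-(y * x * ((x⁻¹ : ℝ) + s * d) * I))‖ =
      Real.exp (-(-(y * d.im) * (x * s))) := by
    rw [norm_exp_neg_mul_mul_I, add_im, ofReal_im, im_ofReal_mul]
    ring_nf
  rw [norm_mul, norm_mul, hexp]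
  calc _ ≤ Real.exp (-(-(y * d.im) * (x * s))) *
        (C * (‖d‖ ^ (α - 1) * (x⁻¹ + s) ^ (α - 1))) * ‖d‖ := by gcongr
    _ = _ := by ring

theorem eventually_isBigO_integral_slanted_exp_mul {f : ℂ → ℂ} {κ α y : ℝ} {d : ℂ} (hα : 1 ≤ α)
    (hf : f =O[𝓝[sector κ] 0] fun t => ‖t‖ ^ (α - 1)) (hre : d.re = 1) (him : |d.im| < κ)
    (hy : y * d.im < 0) :
    ∀ᶠ σ in 𝓝[>] (0 : ℝ), (fun x : ℝ => ∫ s in (0 : ℝ)..σ,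
      exp (-(y * x * ((x⁻¹ : ℝ) + s * d) * I)) * f ((x⁻¹ : ℝ) + s * d) * d)
        =O[atTop] fun x => x ^ (-α) := by
  obtain ⟨C, hC₀, hC⟩ := hf.exists_pos
  obtain ⟨δ, hδ, hCδ⟩ := Metric.mem_nhdsWithin_iff.1 hC.bound
  have hfδ : ∀ t ∈ sector κ, ‖t‖ < δ → ‖f t‖ ≤ C * ‖t‖ ^ (α - 1) := fun t ht hlt => by
    simpa [abs_of_nonneg (Real.rpow_nonneg (norm_nonneg t) _)] using
      hCδ ⟨mem_ball_zero_iff.2 hlt, ht⟩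
  obtain ⟨B, hB⟩ := exists_integral_inv_add_rpow_mul_exp_neg_le α (neg_pos.2 hy)
  have hd : 0 < ‖d‖ := zero_lt_one.trans_le (by simpa [hre] using abs_re_le_norm d)
  filter_upwards [Ioo_mem_nhdsGT (show 0 < δ / ‖d‖ / 2 by positivity)] with σ hσ
  refine IsBigO.of_bound (C * ‖d‖ ^ (α - 1) * ‖d‖ * B) ?_
  filter_upwards [eventually_gt_atTop 0, eventually_gt_atTop (δ / ‖d‖ / 2)⁻¹] with x hx hxδ
  have hinvδ : x⁻¹ < δ / ‖d‖ / 2 := inv_lt_of_inv_lt₀ (by positivity) hxδ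
  have hbound : ∀ s ∈ Set.Ioc 0 σ, _ := fun s hs =>
    norm_exp_mul_apply_slanted_le (x := x) (y := y) hα hC₀.le hfδ hre him hx hs.1
      (by rw [← lt_div_iff₀' hd]; linarith [hs.2, hσ.2])
  refine (intervalIntegral.norm_integral_le_of_norm_le hσ.1.le (ae_of_all _ hbound) ?_).trans ?_
  · exact ContinuousOn.intervalIntegrable (ContinuousOn.mul (by fun_prop) (ContinuousOn.mul
      (ContinuousOn.rpow_const (by fun_prop) fun _ _ => Or.inr (sub_nonneg.2 hα)) (by fun_prop)))
  · rw [intervalIntegral.integral_const_mul, mul_assoc _ B, Real.norm_of_nonneg (by positivity)]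
    exact mul_le_mul_of_nonneg_left (hB σ x hσ.1.le hx) (by positivity)

theorem isBigO_integral_horizontal_exp_mul {f : ℂ → ℂ} {σ c w y : ℝ} (hσc : σ < c)
    (hf : ContinuousOn (fun t : ℝ => f (t + w * I)) (Set.Icc σ c)) (hy : y * w < 0) (α : ℝ) :
    (fun x : ℝ => ∫ t in (x⁻¹ + σ)..c, exp (-(y * x * (t + w * I) * I)) * f (t + w * I))
      =O[atTop] fun x => x ^ (-α) := by
  obtain ⟨M, hM⟩ := isCompact_Icc.exists_bound_of_continuousOn hf
  have hM₀ : 0 ≤ M := (norm_nonneg _).trans (hM σ ⟨le_rfl, hσc.le⟩)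
  have hdecay : (fun x : ℝ => Real.exp (y * w * x)) =O[atTop] fun x => x ^ (-α) := by
    simpa using (isLittleO_exp_neg_mul_rpow_atTop (neg_pos.2 hy) (-α)).isBigO
  refine (IsBigO.of_bound (M * (c - σ)) ?_).trans hdecay
  filter_upwards [eventually_gt_atTop 0,
    tendsto_inv_atTop_zero.eventually_lt_const (sub_pos.2 hσc)] with x hx hxc
  have hinv : 0 < x⁻¹ := inv_pos.2 hx
  have hle : x⁻¹ + σ ≤ c := by linarith
  have hbound : ∀ t ∈ Set.uIoc (x⁻¹ + σ) c,
      ‖exp (-(y * x * (t + w * I) * I)) * f (t + w * I)‖ ≤ Real.exp (y * w * x) * M := by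
    intro t ht
    rw [Set.uIoc_of_le hle] at ht
    have him : y * x * (t + w * I : ℂ).im = y * w * x := by
      simp only [add_im, ofReal_im, im_ofReal_mul, I_im]
      ring
    rw [norm_mul, norm_exp_neg_mul_mul_I, him]
    gcongr
    exact hM t ⟨by linarith [ht.1], ht.2⟩
  calc _ ≤ Real.exp (y * w * x) * M * |c - (x⁻¹ + σ)| :=
        intervalIntegral.norm_integral_le_of_norm_le_const hbound
    _ ≤ Real.exp (y * w * x) * M * (c - σ) := by
        rw [abs_of_nonneg (sub_nonneg.2 hle)]
        gcongr
        linarith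
    _ = _ := by
        rw [Real.norm_of_nonneg (Real.exp_nonneg _)]
        ring

theorem integral_eq_slanted_add_horizontal_sub_vertical {g : ℂ → ℂ} {a a' b c L σ k : ℝ}
    (hg : DifferentiableOn ℂ g (Set.Ioo a' b ×ℂ Set.Ioo (-L) L)) (ha : a' < a) (hcb : c < b)
    (hσ : 0 ≤ σ) (hac : a + σ ≤ c) (hσk : |σ * k| < L) :
    ∫ t in a..c, g t = (∫ s in (0 : ℝ)..σ, g (a + s * (1 + k * I)) * (1 + k * I)) +
      (∫ t in (a + σ)..c, g (t + (σ * k : ℝ) * I)) -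
      ∫ s in (0 : ℝ)..σ, g (c + s * (k * I)) * (k * I) := by
  have hmem : ∀ t ∈ Set.Icc a c, ∀ w : ℝ, |w| < L →
      (t : ℂ) + w * I ∈ Set.Ioo a' b ×ℂ Set.Ioo (-L) L := by
    intro t ht w hw
    simpa [mem_reProdIm] using ⟨⟨ha.trans_le ht.1, ht.2.trans_lt hcb⟩, abs_lt.1 hw⟩
  have hL : |(0 : ℝ)| < L := by simpa using (abs_nonneg _).trans_lt hσk
  have haU : (a : ℂ) ∈ Set.Ioo a' b ×ℂ Set.Ioo (-L) L := by
    simpa using hmem a ⟨le_rfl, by linarith⟩ 0 hL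
  have hcU : (c : ℂ) ∈ Set.Ioo a' b ×ℂ Set.Ioo (-L) L := by
    simpa using hmem c ⟨by linarith, le_rfl⟩ 0 hL
  have haσ := hmem (a + σ) ⟨by linarith, hac⟩ _ hσk
  have hcσ := hmem c ⟨by linarith, le_rfl⟩ _ hσk
  have haσ_eq : ((a + σ : ℝ) : ℂ) + (σ * k : ℝ) * I = a + σ * (1 + k * I) := by
    push_cast
    ring
  have hcσ_eq : (c : ℂ) + (σ * k : ℝ) * I = c + σ * (k * I) := by
    push_cast
    ring
  obtain ⟨G, hG⟩ := exists_integral_segment_eq_sub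
    (isOpen_Ioo.reProdIm isOpen_Ioo) (((convex_Ioo a' b).linear_preimage reLm).inter
      ((convex_Ioo (-L) L).linear_preimage imLm)) hg
  have hbottom : ∫ t in a..c, g t = G c - G a := by
    simpa using hG 0 1 a c (by linarith) (by simpa using haU) (by simpa using hcU)
  have htop : ∫ t in (a + σ)..c, g (t + (σ * k : ℝ) * I) =
      G (c + σ * (k * I)) - G (a + σ * (1 + k * I)) := by
    rw [← haσ_eq, ← hcσ_eq]
    simpa [add_comm] using hG ((σ * k : ℝ) * I) 1 (a + σ) c hac
      (by simpa [add_comm] using haσ) (by simpa [add_comm] using hcσ)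
  rw [haσ_eq] at haσ
  rw [hcσ_eq] at hcσ
  rw [hbottom, htop, hG a _ 0 σ hσ (by simpa using haU) haσ,
    hG c _ 0 σ hσ (by simpa using hcU) hcσ, ofReal_zero]
  ring_nf

theorem eventually_isBigO_integral_add_vertical {f : ℂ → ℂ} {κ α b c L k y : ℝ}
    (hα : 1 ≤ α) (hc : 0 < c) (hcb : c < b) (hL : 0 < L) (hkκ : |k| < κ) (hyk : y * k < 0)
    (hf : DifferentiableOn ℂ f (Set.Ioo 0 b ×ℂ Set.Ioo (-L) L))
    (hf₀ : f =O[𝓝[sector κ] 0] fun t => ‖t‖ ^ (α - 1))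
    (hfi : IntervalIntegrable (fun t : ℝ => f t) volume 0 c) :
    ∀ᶠ σ in 𝓝[>] (0 : ℝ), (fun x : ℝ => (∫ t in (0 : ℝ)..c, exp (-(y * x * t * I)) * f t) +
      ∫ s in (0 : ℝ)..σ, exp (-(y * x * (c + s * (k * I)) * I)) * f (c + s * (k * I)) * (k * I))
        =O[atTop] fun x => x ^ (-α) := by
  have hslanted := eventually_isBigO_integral_slanted_exp_mul (y := y) (d := 1 + k * I) hα hf₀
    (by simp) (by simpa using hkκ) (by simpa using hyk)
  have hf₀_real : (fun t : ℝ => f t) =O[𝓝[>] 0] fun t => t ^ (α - 1) := by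
    refine (hf₀.comp_tendsto (tendsto_ofReal_nhdsWithin_sector
      ((abs_nonneg k).trans_lt hkκ))).congr' EventuallyEq.rfl ?_
    filter_upwards [eventually_mem_nhdsWithin] with t ht
    simp [abs_of_pos (Set.mem_Ioi.1 ht)]
  have hend := isBigO_integral_zero_inv_exp_mul hα hf₀_real y
  have hσk : ∀ᶠ σ in 𝓝[>] (0 : ℝ), |σ * k| < L :=
    nhdsWithin_le_nhds (ContinuousAt.eventually_lt (by fun_prop) continuousAt_const (by simpa))
  filter_upwards [hslanted, hσk, Ioo_mem_nhdsGT hc] with σ hslanted hσk hσ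
  have hhorizontal := isBigO_integral_horizontal_exp_mul (w := σ * k) (y := y) (f := f) hσ.2
    (hf.continuousOn.comp (by fun_prop) fun t ht =>
      by simpa [mem_reProdIm] using ⟨⟨hσ.1.trans_le ht.1, ht.2.trans_lt hcb⟩, abs_lt.1 hσk⟩)
    (by nlinarith [hσ.1]) α
  refine ((hend.add hslanted).add hhorizontal).congr' ?_ EventuallyEq.rfl
  filter_upwards [eventually_gt_atTop 0,
    tendsto_inv_atTop_zero.eventually_lt_const (sub_pos.2 hσ.2)] with x hx hxc
  have hinv : 0 < x⁻¹ := inv_pos.2 hx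
  have hcontour := integral_eq_slanted_add_horizontal_sub_vertical
    (g := fun z => exp (-(y * x * z * I)) * f z) (DifferentiableOn.mul (by fun_prop) hf) hinv hcb
    hσ.1.le (by linarith) hσk
  have hint : IntervalIntegrable (fun t : ℝ => exp (-(y * x * t * I)) * f t) volume 0 c :=
    hfi.continuousOn_mul (by fun_prop)
  have hle : x⁻¹ ∈ Set.uIcc 0 c := Set.mem_uIcc_of_le hinv.le (by linarith [hσ.1])
  rw [← intervalIntegral.integral_add_adjacent_intervals
    (hint.mono_set (Set.uIcc_subset_uIcc_left hle))
    (hint.mono_set (Set.uIcc_subset_uIcc_right hle)), hcontour]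
  ring

theorem integral_add_vertical_exp {x y : ℝ} (hx : x ≠ 0) (hy : y ≠ 0) (c σ k : ℝ) :
    (∫ t in (0 : ℝ)..c, exp (-(y * x * t * I))) +
        ∫ s in (0 : ℝ)..σ, exp (-(y * x * (c + s * (k * I)) * I)) * (k * I) =
      I / (y * x) * (exp (-(y * x * (c + σ * (k * I)) * I)) - 1) := by
  have hxy : (y * x : ℂ) ≠ 0 := by exact_mod_cast mul_ne_zero hy hx
  set E : ℂ → ℂ := fun z => I / (y * x) * exp (-(y * x * z * I)) with hE
  have hderiv : ∀ z, HasDerivAt E (exp (-(y * x * z * I))) z := by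
    intro z
    have hlin : HasDerivAt (fun z : ℂ => -(y * x * z * I)) (-(y * x * I)) z := by
      simpa using (((hasDerivAt_id z).const_mul (y * x : ℂ)).mul_const I).fun_neg
    refine (hlin.cexp.const_mul _).congr_deriv ?_
    field_simp
    rw [I_sq, neg_one_mul, neg_mul, neg_div, neg_neg, div_self hxy]
  have hbottom := integral_segment_eq_sub (G := E) (g := fun z => exp (-(y * x * z * I)))
    (z := 0) (v := 1) (a := 0) (b := c) (fun _ _ => hderiv _) (by fun_prop)
  have hvertical := integral_segment_eq_sub (G := E) (g := fun z => exp (-(y * x * z * I)))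
    (z := c) (v := k * I) (a := 0) (b := σ) (fun _ _ => hderiv _) (by fun_prop)
  simp only [zero_add, mul_one] at hbottom
  rw [hbottom, hvertical]
  simp only [hE, ofReal_zero, mul_zero, zero_mul, neg_zero, exp_zero, add_zero]
  ring

theorem isBigO_integral_add_vertical_exp_add {y c σ k : ℝ} (hσ : 0 < σ) (hyk : y * k < 0) (α : ℝ) :
    (fun x : ℝ => (∫ t in (0 : ℝ)..c, exp (-(y * x * t * I))) +
      (∫ s in (0 : ℝ)..σ, exp (-(y * x * (c + s * (k * I)) * I)) * (k * I)) + I / (y * x))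
        =O[atTop] fun x => x ^ (-α) := by
  have hy : y ≠ 0 := left_ne_zero_of_mul hyk.ne
  have hdecay : (fun x : ℝ => Real.exp (y * k * σ * x)) =O[atTop] fun x => x ^ (-α) := by
    simpa using (isLittleO_exp_neg_mul_rpow_atTop (neg_pos.2 (mul_neg_of_neg_of_pos hyk hσ))
      (-α)).isBigO
  refine (IsBigO.of_bound |y|⁻¹ ?_).trans hdecay
  filter_upwards [eventually_ge_atTop 1] with x hx
  have him : y * x * (c + σ * (k * I) : ℂ).im = y * k * σ * x := by
    simp only [add_im, ofReal_im, im_ofReal_mul, I_im]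
    ring
  rw [integral_add_vertical_exp (by positivity) hy, ← mul_add_one, sub_add_cancel, norm_mul,
    norm_exp_neg_mul_mul_I, him, Real.norm_of_nonneg (Real.exp_nonneg _)]
  gcongr
  rw [norm_div, norm_I, norm_mul, norm_real, norm_real, Real.norm_eq_abs, Real.norm_eq_abs,
    one_div, mul_inv]
  exact mul_le_of_le_one_right (by positivity) (inv_le_one_of_one_le₀ (hx.trans (le_abs_self x)))

theorem eventually_isBigO_integral_add_vertical_add {f : ℂ → ℂ} {κ α b c L k y : ℝ} {a : ℂ}
    (hα : 1 ≤ α) (hc : 0 < c) (hcb : c < b) (hL : 0 < L) (hkκ : |k| < κ) (hyk : y * k < 0)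
    (hf : DifferentiableOn ℂ f (Set.Ioo 0 b ×ℂ Set.Ioo (-L) L))
    (hf₀ : (fun t => f t - a) =O[𝓝[sector κ] 0] fun t => ‖t‖ ^ (α - 1))
    (hfi : IntervalIntegrable (fun t : ℝ => f t) volume 0 c) :
    ∀ᶠ σ in 𝓝[>] (0 : ℝ), (fun x : ℝ => (∫ t in (0 : ℝ)..c, exp (-(y * x * t * I)) * f t) +
      (∫ s in (0 : ℝ)..σ, exp (-(y * x * (c + s * (k * I)) * I)) * f (c + s * (k * I)) * (k * I)) +
        a * (I / (y * x))) =O[atTop] fun x => x ^ (-α) := by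
  have hσk : ∀ᶠ σ in 𝓝[>] (0 : ℝ), |σ * k| < L :=
    nhdsWithin_le_nhds (ContinuousAt.eventually_lt (by fun_prop) continuousAt_const (by simpa))
  filter_upwards [eventually_isBigO_integral_add_vertical hα hc hcb hL hkκ hyk
    (hf.sub_const a) hf₀ (hfi.sub intervalIntegrable_const), hσk, eventually_mem_nhdsWithin]
    with σ hsub hσk (hσ : 0 < σ)
  have hconst := (isBigO_integral_add_vertical_exp_add (c := c) hσ hyk α).const_mul_left a
  refine (hsub.add hconst).congr_left fun x => ?_
  have hmem : ∀ s ∈ Set.uIcc 0 σ, (c : ℂ) + s * (k * I) ∈ Set.Ioo 0 b ×ℂ Set.Ioo (-L) L := by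
    intro s hs
    rw [Set.uIcc_of_le hσ.le] at hs
    have hsk : |s * k| < L := by
      rw [abs_mul, abs_of_pos hσ] at hσk
      rw [abs_mul, abs_of_nonneg hs.1]
      exact (mul_le_mul_of_nonneg_right hs.2 (abs_nonneg k)).trans_lt hσk
    simpa [mem_reProdIm] using ⟨⟨hc, hcb⟩, abs_lt.1 hsk⟩
  have hreal : ∫ t in (0 : ℝ)..c, exp (-(y * x * t * I)) * (f t - a) =
      (∫ t in (0 : ℝ)..c, exp (-(y * x * t * I)) * f t) -
        (∫ t in (0 : ℝ)..c, exp (-(y * x * t * I))) * a := by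
    rw [← intervalIntegral.integral_mul_const, ← intervalIntegral.integral_sub]
    · simp only [mul_sub]
    · exact hfi.continuousOn_mul (by fun_prop)
    · exact Continuous.intervalIntegrable (by fun_prop) _ _
  have hvert : ∫ s in (0 : ℝ)..σ, exp (-(y * x * (c + s * (k * I)) * I)) *
        (f (c + s * (k * I)) - a) * (k * I) =
      (∫ s in (0 : ℝ)..σ, exp (-(y * x * (c + s * (k * I)) * I)) * f (c + s * (k * I)) * (k * I)) -
        (∫ s in (0 : ℝ)..σ, exp (-(y * x * (c + s * (k * I)) * I)) * (k * I)) * a := by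
    rw [← intervalIntegral.integral_mul_const, ← intervalIntegral.integral_sub]
    · simp only [mul_sub, sub_mul, mul_right_comm]
    · exact (((by fun_prop : Continuous fun s : ℝ => exp _).continuousOn.mul
        (hf.continuousOn.comp (by fun_prop) hmem)).mul continuousOn_const).intervalIntegrable
    · exact Continuous.intervalIntegrable (by fun_prop) _ _
  rw [hreal, hvert]
  ring

theorem exp_neg_mul_two_pi_sub {y : ℝ} (hy : |y| = 1) (n : ℕ) (t : ℂ) :
    exp (-(y * n * (2 * Real.pi - t) * I)) = exp (-((-y : ℝ) * n * t * I)) := by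
  have hperiod : exp (-(y * n * (2 * Real.pi) * I)) = 1 := by
    rcases eq_or_eq_neg_of_abs_eq hy with rfl | rfl
    · exact exp_eq_one_iff.2 ⟨-n, by push_cast; ring⟩
    · exact exp_eq_one_iff.2 ⟨n, by push_cast; ring⟩
  calc _ = exp (-(y * n * (2 * Real.pi) * I)) * exp (-((-y : ℝ) * n * t * I)) := by
        rw [← exp_add]
        push_cast
        ring_nf
    _ = _ := by rw [hperiod, one_mul]

theorem integral_exp_mul_eq_add_integral_reflect {f : ℂ → ℂ} {y : ℝ} (hy : |y| = 1)
    (hfi : IntervalIntegrable (fun t : ℝ => f t) volume 0 (2 * Real.pi)) (n : ℕ) :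
    ∫ t in (0 : ℝ)..(2 * Real.pi), exp (-(y * n * t * I)) * f t =
      (∫ t in (0 : ℝ)..Real.pi, exp (-(y * n * t * I)) * f t) +
        ∫ t in (0 : ℝ)..Real.pi, exp (-((-y : ℝ) * n * t * I)) * f (2 * Real.pi - t) := by
  have hpi_mem : Real.pi ∈ Set.uIcc 0 (2 * Real.pi) :=
    Set.mem_uIcc_of_le Real.pi_pos.le (by linarith [Real.pi_pos])
  have hint : IntervalIntegrable (fun t : ℝ => exp (-(y * n * t * I)) * f t) volume 0
      (2 * Real.pi) := hfi.continuousOn_mul (by fun_prop)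
  have hreflect := intervalIntegral.integral_comp_sub_left (a := 0) (b := Real.pi)
    (fun t : ℝ => exp (-(y * n * t * I)) * f t) (2 * Real.pi)
  rw [sub_zero, show 2 * Real.pi - Real.pi = Real.pi by ring] at hreflect
  rw [← intervalIntegral.integral_add_adjacent_intervals
    (hint.mono_set (Set.uIcc_subset_uIcc_left hpi_mem))
    (hint.mono_set (Set.uIcc_subset_uIcc_right hpi_mem)), ← hreflect]
  simp only [ofReal_sub, ofReal_mul, ofReal_ofNat, exp_neg_mul_two_pi_sub hy]

theorem exp_mul_vertical_reflect (f : ℂ → ℂ) {y : ℝ} (hy : |y| = 1) (k s : ℝ) (n : ℕ) :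
    exp (-((-y : ℝ) * n * (Real.pi + s * ((-k : ℝ) * I)) * I)) *
        f (2 * Real.pi - (Real.pi + s * ((-k : ℝ) * I))) * ((-k : ℝ) * I) =
      -(exp (-(y * n * (Real.pi + s * (k * I)) * I)) * f (Real.pi + s * (k * I)) * (k * I)) := by
  have hpoint : (2 * Real.pi : ℂ) - (Real.pi + s * ((-k : ℝ) * I)) = Real.pi + s * (k * I) := by
    push_cast
    ring
  rw [← exp_neg_mul_two_pi_sub hy, hpoint, ofReal_neg, neg_mul, mul_neg]

theorem differentiableOn_comp_sub_reProdIm {f : ℂ → ℂ} {b L : ℝ}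
    (hf : DifferentiableOn ℂ f (Set.Ioo 0 b ×ℂ Set.Ioo (-L) L)) :
    DifferentiableOn ℂ (fun t => f (b - t)) (Set.Ioo 0 b ×ℂ Set.Ioo (-L) L) := by
  refine hf.comp (by fun_prop) fun t ht => ?_
  simp only [mem_reProdIm, Set.mem_Ioo, sub_re, sub_im, ofReal_re, ofReal_im, zero_sub] at ht ⊢
  constructor <;> constructor <;> linarith [ht.1.1, ht.1.2, ht.2.1, ht.2.2]

theorem isBigO_integral_exp_mul_add {f : ℂ → ℂ} {κ α L y : ℝ} {a b : ℂ} (hκ : 0 < κ) (hα : 1 ≤ α)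
    (hL : 0 < L) (hy : |y| = 1)
    (hf : DifferentiableOn ℂ f (Set.Ioo 0 (2 * Real.pi) ×ℂ Set.Ioo (-L) L))
    (ha : (fun t => f t - a) =O[𝓝[sector κ] 0] fun t => ‖t‖ ^ (α - 1))
    (hb : (fun t => f (2 * Real.pi - t) - b) =O[𝓝[sector κ] 0] fun t => ‖t‖ ^ (α - 1))
    (hfi : IntervalIntegrable (fun t : ℝ => f t) volume 0 (2 * Real.pi)) :
    (fun n : ℕ => (∫ t in (0 : ℝ)..(2 * Real.pi), exp (-(y * n * t * I)) * f t) +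
      (a - b) * (I / (y * n))) =O[atTop] fun n => (n : ℝ) ^ (-α) := by
  have hpi := Real.pi_pos
  obtain ⟨k, hkκ, hyk⟩ : ∃ k : ℝ, |k| < κ ∧ y * k < 0 := by
    refine ⟨-(y * (κ / 2)), ?_, ?_⟩
    · rw [abs_neg, abs_mul, hy, abs_of_pos (half_pos hκ), one_mul]
      exact half_lt_self hκ
    · rw [mul_neg, ← mul_assoc, ← abs_mul_abs_self, hy, one_mul, one_mul, neg_lt_zero]
      exact half_pos hκ
  have hpi_mem : Real.pi ∈ Set.uIcc 0 (2 * Real.pi) := Set.mem_uIcc_of_le hpi.le (by linarith)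
  have hleft := eventually_isBigO_integral_add_vertical_add hα hpi (by linarith) hL hkκ hyk hf ha
    (hfi.mono_set (Set.uIcc_subset_uIcc_left hpi_mem))
  have hreflect : DifferentiableOn ℂ (fun t => f (2 * Real.pi - t))
      (Set.Ioo 0 (2 * Real.pi) ×ℂ Set.Ioo (-L) L) := by
    simpa using differentiableOn_comp_sub_reProdIm hf
  have hreflect_int : IntervalIntegrable (fun t : ℝ => f (2 * Real.pi - t)) volume 0 Real.pi := by
    have h := (hfi.mono_set (Set.uIcc_subset_uIcc_right hpi_mem)).comp_sub_left (2 * Real.pi)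
    rw [sub_self, two_mul, add_sub_cancel_right] at h
    simpa [two_mul] using h.symm
  have hright := eventually_isBigO_integral_add_vertical_add (f := fun t => f (2 * Real.pi - t))
    (y := -y) (k := -k) hα hpi (by linarith) hL (by rwa [abs_neg]) (by rwa [neg_mul_neg])
    hreflect hb hreflect_int
  -- The two contours have the same vertical part, described with opposite orientations.
  obtain ⟨σ, hleft, hright⟩ := (hleft.and hright).exists
  refine ((hleft.add hright).comp_tendsto tendsto_natCast_atTop_atTop).congr_left fun n => ?_
  have hsign : I / ((-y : ℝ) * n) = -(I / (y * n)) := by rw [ofReal_neg, neg_mul, div_neg]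
  rw [integral_exp_mul_eq_add_integral_reflect hy hfi]
  simp only [Function.comp_apply, ofReal_natCast, exp_mul_vertical_reflect f hy,
    intervalIntegral.integral_neg]
  linear_combination b * hsign

theorem isBigO_fourierCoeffOn_sub {f : ℂ → ℂ} {κ α L : ℝ} {a b : ℂ} (hκ : 0 < κ) (hα : 1 ≤ α)
    (hL : 0 < L) (hf : DifferentiableOn ℂ f (Set.Ioo 0 (2 * Real.pi) ×ℂ Set.Ioo (-L) L))
    (ha : (fun t => f t - a) =O[𝓝[sector κ] 0] fun t => ‖t‖ ^ (α - 1))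
    (hb : (fun t => f (2 * Real.pi - t) - b) =O[𝓝[sector κ] 0] fun t => ‖t‖ ^ (α - 1))
    (hfi : IntervalIntegrable (fun t : ℝ => f t) volume 0 (2 * Real.pi)) :
    (fun m : ℤ => fourierCoeffOn Real.two_pi_pos (fun t : ℝ => f t) m -
      (b - a) / (2 * Real.pi) * (I / m)) =O[cofinite] fun m => |(m : ℝ)| ^ (-α) := by
  have hsign : ∀ y : ℤ, |(y : ℝ)| = 1 →
      (fun n : ℕ => fourierCoeffOn Real.two_pi_pos (fun t : ℝ => f t) (y * n) -
        (b - a) / (2 * Real.pi) * (I / (y * n : ℤ))) =O[atTop]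
          fun n => |((y * n : ℤ) : ℝ)| ^ (-α) := by
    intro y hy
    have h := (isBigO_integral_exp_mul_add hκ hα hL hy hf ha hb hfi).const_mul_left
      (1 / (2 * Real.pi))
    refine h.congr (fun n => ?_) fun n => ?_
    · rw [fourierCoeffOn_two_pi]
      push_cast
      ring
    · rw [Int.cast_mul, abs_mul, hy, one_mul, Int.cast_natCast, Nat.abs_cast]
  rw [Int.cofinite_eq, isBigO_sup]
  constructor
  · rw [← map_neg_atTop, ← Nat.map_cast_int_atTop, isBigO_map, isBigO_map]
    simpa [Function.comp_def] using hsign (-1) (by simp)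
  · rw [← Nat.map_cast_int_atTop, isBigO_map]
    simpa [Function.comp_def] using hsign 1 (by simp)

/-! ### Aliasing for the trapezoidal rule -/

/-- The trapezoidal sum with `m` subintervals of a function on `[0, 2π]`, on which the error
analysis is carried out in the angular variable. -/
noncomputable def trapezoidalSum (m : ℕ) (g : ℝ → ℂ) : ℂ :=
  2 * Real.pi / m *
    (g 0 / 2 + ∑ j ∈ Finset.Ico 1 m, g (2 * Real.pi * j / m) + g (2 * Real.pi) / 2)

/-- The error (sum minus integral) of the trapezoidal rule with `m` subintervals on `[0, 2π]`. -/
noncomputable def trapezoidalError (m : ℕ) (g : ℝ → ℂ) : ℂ :=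
  trapezoidalSum m g - ∫ t in (0 : ℝ)..(2 * Real.pi), g t

theorem trapezoidalError_add {m : ℕ} {g h : ℝ → ℂ}
    (hg : IntervalIntegrable g volume 0 (2 * Real.pi))
    (hh : IntervalIntegrable h volume 0 (2 * Real.pi)) :
    trapezoidalError m (fun t => g t + h t) = trapezoidalError m g + trapezoidalError m h := by
  simp only [trapezoidalError, trapezoidalSum, intervalIntegral.integral_add hg hh,
    Finset.sum_add_distrib]
  ring

theorem trapezoidalError_const_mul (m : ℕ) (c : ℂ) (g : ℝ → ℂ) :
    trapezoidalError m (fun t => c * g t) = c * trapezoidalError m g := by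
  simp only [trapezoidalError, trapezoidalSum, intervalIntegral.integral_const_mul,
    ← Finset.mul_sum]
  ring

theorem trapezoidalError_sum {ι : Type*} {m : ℕ} (s : Finset ι) {g : ι → ℝ → ℂ}
    (hg : ∀ i ∈ s, IntervalIntegrable (g i) volume 0 (2 * Real.pi)) :
    trapezoidalError m (fun t => ∑ i ∈ s, g i t) = ∑ i ∈ s, trapezoidalError m (g i) := by
  simp only [trapezoidalError, trapezoidalSum]
  rw [intervalIntegral.integral_finsetSum hg, Finset.sum_sub_distrib, ← Finset.mul_sum,
    Finset.sum_add_distrib, Finset.sum_add_distrib, Finset.sum_comm, Finset.sum_div,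
    Finset.sum_div]

theorem trapezoidalSum_of_periodic {m : ℕ} (hm : m ≠ 0) {g : ℝ → ℂ}
    (hg : g 0 = g (2 * Real.pi)) :
    trapezoidalSum m g = 2 * Real.pi / m * ∑ j ∈ Finset.range m, g (2 * Real.pi * j / m) := by
  rw [trapezoidalSum, Finset.range_eq_Ico, Finset.sum_eq_sum_Ico_succ_bot (by omega : 0 < m), ← hg]
  simp only [Nat.cast_zero, mul_zero, zero_div, zero_add]
  ring

theorem exp_int_mul_two_pi (k : ℤ) : exp (k * ((2 * Real.pi : ℝ) : ℂ) * I) = 1 :=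
  exp_eq_one_iff.2 ⟨k, by push_cast; ring⟩

theorem exp_int_mul_grid (m : ℕ) (k : ℤ) (j : ℕ) :
    exp (k * ((2 * Real.pi * j / m : ℝ) : ℂ) * I) = (exp (2 * Real.pi * I / m) ^ k) ^ j := by
  rw [← exp_int_mul, ← exp_nat_mul]
  push_cast
  ring_nf

theorem exp_zpow_eq_one_iff {m : ℕ} (hm : m ≠ 0) (k : ℤ) :
    exp (2 * Real.pi * I / m) ^ k = 1 ↔ (m : ℤ) ∣ k :=
  (Complex.isPrimitiveRoot_exp m hm).zpow_eq_one_iff_dvd k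

theorem exp_zpow_pow_eq_one {m : ℕ} (hm : m ≠ 0) (k : ℤ) :
    (exp (2 * Real.pi * I / m) ^ k) ^ m = 1 := by
  rw [← zpow_natCast, ← zpow_mul, exp_zpow_eq_one_iff hm]
  exact dvd_mul_left _ _

theorem sum_exp_int_mul_grid {m : ℕ} (hm : m ≠ 0) (k : ℤ) :
    ∑ j ∈ Finset.range m, exp (k * ((2 * Real.pi * j / m : ℝ) : ℂ) * I) =
      if (m : ℤ) ∣ k then (m : ℂ) else 0 := by
  simp only [exp_int_mul_grid]
  split_ifs with hdvd
  · simp [(exp_zpow_eq_one_iff hm k).2 hdvd]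
  · rw [geom_sum_eq (mt (exp_zpow_eq_one_iff hm k).1 hdvd), exp_zpow_pow_eq_one hm, sub_self,
      zero_div]

theorem grid_mem_Ico {m j : ℕ} (hj : j < m) :
    2 * Real.pi * j / m ∈ Set.Ico 0 (2 * Real.pi) := by
  have hj' : (j : ℝ) < m := by exact_mod_cast hj
  refine ⟨by positivity, ?_⟩
  rw [div_lt_iff₀ (by exact_mod_cast Nat.zero_lt_of_lt hj)]
  gcongr

theorem hasSum_trapezoidalSum {v : ℝ → ℂ} (hv : ContinuousOn v (Set.Icc 0 (2 * Real.pi)))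
    (hper : v 0 = v (2 * Real.pi)) (hs : Summable (fourierCoeffOn Real.two_pi_pos v)) {m : ℕ}
    (hm : m ≠ 0) (k : ℤ) :
    HasSum
      (fun s : ℤ => if (m : ℤ) ∣ s + k then 2 * Real.pi * fourierCoeffOn Real.two_pi_pos v s else 0)
      (trapezoidalSum m fun t => exp (k * t * I) * v t) := by
  have hgrid : ∀ j ∈ Finset.range m,
      HasSum (fun s : ℤ => fourierCoeffOn Real.two_pi_pos v s *
          exp ((s + k : ℤ) * ((2 * Real.pi * j / m : ℝ) : ℂ) * I))
        (exp (k * ((2 * Real.pi * j / m : ℝ) : ℂ) * I) * v (2 * Real.pi * j / m)) := by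
    intro j hj
    refine ((hasSum_fourierCoeffOn_two_pi hv hper hs
      (grid_mem_Ico (Finset.mem_range.1 hj))).mul_left _).congr_fun fun s => ?_
    rw [mul_left_comm, ← exp_add]
    push_cast
    ring_nf
  rw [trapezoidalSum_of_periodic hm (by
    simp only [exp_int_mul_two_pi, ofReal_zero, mul_zero, zero_mul, exp_zero, hper])]
  refine ((hasSum_sum hgrid).mul_left (2 * Real.pi / m : ℂ)).congr_fun fun s => ?_
  rw [← Finset.mul_sum, sum_exp_int_mul_grid hm]
  split_ifs
  · field_simp
  · simp

theorem integral_exp_int_mul_mul (v : ℝ → ℂ) (k : ℤ) :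
    ∫ t in (0 : ℝ)..(2 * Real.pi), exp (k * t * I) * v t =
      2 * Real.pi * fourierCoeffOn Real.two_pi_pos v (-k) := by
  rw [fourierCoeffOn_two_pi]
  push_cast
  simp only [neg_mul, neg_neg]
  rw [← mul_assoc, mul_one_div_cancel (by simp [Real.pi_ne_zero]), one_mul]

theorem hasSum_trapezoidalError {v : ℝ → ℂ} (hv : ContinuousOn v (Set.Icc 0 (2 * Real.pi)))
    (hper : v 0 = v (2 * Real.pi)) (hs : Summable (fourierCoeffOn Real.two_pi_pos v)) {m : ℕ}
    (hm : m ≠ 0) (k : ℤ) :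
    HasSum (fun l : ℤ =>
        if l = 0 then 0 else 2 * Real.pi * fourierCoeffOn Real.two_pi_pos v (m * l - k))
      (trapezoidalError m fun t => exp (k * t * I) * v t) := by
  have hsum := (hasSum_trapezoidalSum hv hper hs hm k).sub
    (hasSum_ite_eq (-k) (2 * Real.pi * fourierCoeffOn Real.two_pi_pos v (-k)))
  rw [← integral_exp_int_mul_mul, ← trapezoidalError, integral_exp_int_mul_mul] at hsum
  have hinj : Function.Injective fun l : ℤ => m * l - k := fun a b hab => by
    simpa [sub_left_inj, hm] using hab
  rw [← hinj.hasSum_iff] at hsum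
  · refine hsum.congr_fun fun l => ?_
    have hk : (m * l - k = -k) ↔ l = 0 := by simp [sub_eq_neg_self, hm]
    simp only [Function.comp_apply, sub_add_cancel, dvd_mul_right, if_true, hk]
    split_ifs with hl
    · simp [hl]
    · simp
  · intro s hs'
    have hdvd : ¬ (m : ℤ) ∣ s + k := by
      rintro ⟨l, hl⟩
      exact hs' ⟨l, by simp only [← hl, add_sub_cancel_right]⟩
    have hsk : s ≠ -k := by rintro rfl; simp at hdvd
    simp [hdvd, hsk]

theorem half_mul_abs_le_abs_mul_sub {m : ℕ} {k l : ℤ} (hk : 2 * |k| ≤ m) (hl : l ≠ 0) :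
    (m : ℝ) / 2 * |(l : ℝ)| ≤ |((m * l - k : ℤ) : ℝ)| := by
  have hk' : 2 * |(k : ℝ)| ≤ m := by exact_mod_cast hk
  have hl' : 1 ≤ |(l : ℝ)| := by exact_mod_cast Int.one_le_abs hl
  have htri := abs_sub_abs_le_abs_sub ((m : ℝ) * l) k
  rw [abs_mul, Nat.abs_cast] at htri
  push_cast
  nlinarith [(Nat.cast_nonneg m : (0 : ℝ) ≤ m)]

theorem summable_of_isBigO_abs_rpow {c : ℤ → ℂ} {α : ℝ} (hα : 1 < α)
    (hc : c =O[cofinite] fun s => |(s : ℝ)| ^ (-α)) : Summable c :=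
  summable_of_isBigO (Real.summable_abs_int_rpow hα) hc

theorem exists_norm_le_of_isBigO_cofinite {c : ℤ → ℂ} {g : ℝ → ℝ}
    (hc : c =O[cofinite] fun s => g |(s : ℝ)|) :
    ∃ C, 0 ≤ C ∧ ∃ M : ℕ, ∀ s : ℤ, (M : ℝ) < |(s : ℝ)| → ‖c s‖ ≤ C * ‖g |(s : ℝ)|‖ := by
  obtain ⟨C, hC0, hC⟩ := hc.exists_nonneg
  obtain ⟨M, hM⟩ := ((eventually_cofinite.1 hC.bound).image Int.natAbs).bddAbove
  refine ⟨C, hC0, M, fun s hs => ?_⟩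
  by_contra hlt
  have := hM (Set.mem_image_of_mem _ hlt)
  rw [← Int.cast_abs, Int.abs_eq_natAbs] at hs
  norm_cast at hs
  omega

/-- The Fourier frequencies seen by the rule applied to `e^{ikt} v` are `m l - k` with `l ≠ 0`, and
all of them are at least `m / 2` in absolute value. -/
theorem exists_norm_trapezoidalError_exp_mul_le {v : ℝ → ℂ}
    (hv : ContinuousOn v (Set.Icc 0 (2 * Real.pi))) (hper : v 0 = v (2 * Real.pi)) {α : ℝ}
    (hα : 1 < α)
    (hdecay : fourierCoeffOn Real.two_pi_pos v =O[cofinite] fun s : ℤ => |(s : ℝ)| ^ (-α)) :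
    ∃ C, ∀ᶠ m : ℕ in atTop, ∀ k : ℤ, 2 * |k| ≤ m →
      ‖trapezoidalError m fun t => exp (k * t * I) * v t‖ ≤ C * (m : ℝ) ^ (-α) := by
  obtain ⟨C, hC0, M, hM⟩ := exists_norm_le_of_isBigO_cofinite (g := fun x => x ^ (-α)) hdecay
  refine ⟨2 * Real.pi * C * 2 ^ α * ∑' l : ℤ, |(l : ℝ)| ^ (-α), ?_⟩
  filter_upwards [eventually_gt_atTop (2 * M), eventually_ne_atTop 0] with m hm hm0 k hk
  have hmM : (M : ℝ) < m / 2 := by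
    rw [lt_div_iff₀ two_pos, mul_comm]
    exact_mod_cast hm
  rw [← (hasSum_trapezoidalError hv hper (summable_of_isBigO_abs_rpow hα hdecay) hm0 k).tsum_eq]
  refine tsum_of_norm_bounded (((Real.summable_abs_int_rpow hα).hasSum.mul_left
    (2 * Real.pi * C * 2 ^ α)).mul_right ((m : ℝ) ^ (-α))) fun l => ?_
  split_ifs with hl
  · rw [norm_zero]
    positivity
  have hfreq := half_mul_abs_le_abs_mul_sub hk hl
  have hl1 : 1 ≤ |(l : ℝ)| := by exact_mod_cast Int.one_le_abs hl
  have : 0 < |(l : ℝ)| := by linarith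
  calc ‖2 * Real.pi * fourierCoeffOn Real.two_pi_pos v (m * l - k)‖
      = 2 * Real.pi * ‖fourierCoeffOn Real.two_pi_pos v (m * l - k)‖ := by
        rw [norm_mul, norm_mul, Complex.norm_two, norm_real, Real.norm_of_nonneg Real.pi_pos.le]
    _ ≤ 2 * Real.pi * (C * |((m * l - k : ℤ) : ℝ)| ^ (-α)) := by
        gcongr
        rw [← Real.norm_of_nonneg (Real.rpow_nonneg (abs_nonneg ((m * l - k : ℤ) : ℝ)) (-α))]
        exact hM _ ((hmM.trans_le (le_mul_of_one_le_right (by positivity) hl1)).trans_le hfreq)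
    _ ≤ 2 * Real.pi * (C * ((m : ℝ) / 2 * |(l : ℝ)|) ^ (-α)) := by
        gcongr 2 * Real.pi * (C * ?_)
        exact Real.rpow_le_rpow_of_nonpos (by positivity) hfreq (by linarith)
    _ = 2 * Real.pi * C * 2 ^ α * |(l : ℝ)| ^ (-α) * (m : ℝ) ^ (-α) := by
        rw [Real.mul_rpow (by positivity) (by positivity), Real.div_rpow (by positivity) two_pos.le,
          Real.rpow_neg two_pos.le]
        field_simp

/-! ### The trapezoidal error of `t e^{ikt}` -/

theorem integral_exp_int_mul {k : ℤ} (hk : k ≠ 0) :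
    ∫ t in (0 : ℝ)..(2 * Real.pi), exp (k * t * I) = 0 := by
  have hkI : (k : ℂ) * I ≠ 0 := mul_ne_zero (by exact_mod_cast hk) I_ne_zero
  have h := integral_exp_mul_complex (a := 0) (b := 2 * Real.pi) hkI
  simp only [mul_right_comm (k : ℂ) I, exp_int_mul_two_pi] at h
  simp [h]

theorem integral_exp_int_mul_id {k : ℤ} (hk : k ≠ 0) :
    ∫ t in (0 : ℝ)..(2 * Real.pi), exp (k * t * I) * t = -(2 * Real.pi * I / k) := by
  have hk' : (k : ℂ) ≠ 0 := by exact_mod_cast hk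
  have hderiv : ∀ t : ℝ, HasDerivAt (fun t : ℝ => exp (k * t * I) * (-(t * I / k) + 1 / k ^ 2))
      (exp (k * t * I) * t) t := by
    intro t
    have hid : HasDerivAt (fun t : ℝ => (t : ℂ)) 1 t := (hasDerivAt_id' t).ofReal_comp
    refine ((((hid.const_mul (k : ℂ)).mul_const I).cexp).mul
      ((((hid.mul_const I).div_const (k : ℂ)).fun_neg).add_const
        (1 / (k : ℂ) ^ 2))).congr_deriv ?_
    field_simp
    linear_combination (-(t : ℂ) * k) * I_sq
  rw [intervalIntegral.integral_eq_sub_of_hasDerivAt (fun t _ => hderiv t)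
    (Continuous.intervalIntegrable (by fun_prop) _ _), exp_int_mul_two_pi]
  simp only [ofReal_zero, mul_zero, zero_mul, exp_zero]
  push_cast
  field_simp
  ring

theorem sum_range_cast_mul_pow {w : ℂ} {N : ℕ} (hw : w ≠ 1) (hN : w ^ N = 1) :
    ∑ j ∈ Finset.range N, (j : ℂ) * w ^ j = N / (w - 1) := by
  have hpartial : ∀ M : ℕ, (w - 1) ^ 2 * ∑ j ∈ Finset.range M, (j : ℂ) * w ^ j =
      M * w ^ M * (w - 1) - w * (w ^ M - 1) := by
    intro M
    induction M with
    | zero => simp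
    | succ M ih =>
      rw [Finset.sum_range_succ, mul_add, ih]
      push_cast
      ring
  have hw' : w - 1 ≠ 0 := sub_ne_zero.2 hw
  rw [eq_div_iff hw']
  apply mul_left_cancel₀ hw'
  linear_combination hpartial N + (N * (w - 1) - w) * hN

/-- The `j`-th pair of terms in the partial fraction expansion of the error of the rule with `m`
subintervals for `t e^{ikt}`; it comes from the aliased frequencies `±m(j+1) - k`. -/
noncomputable def aliasTerm (m : ℕ) (k : ℤ) (j : ℕ) : ℝ :=
  1 / (m * (j + 1) - k) - 1 / (m * (j + 1) + k)

theorem aliasTerm_zero (m j : ℕ) : aliasTerm m 0 j = 0 := by simp [aliasTerm]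

theorem aliasTerm_neg (m : ℕ) (k : ℤ) (j : ℕ) : aliasTerm m (-k) j = -aliasTerm m k j := by
  rw [aliasTerm, aliasTerm, Int.cast_neg, sub_neg_eq_add, ← sub_eq_add_neg, neg_sub]

theorem ne_zero_of_abs_lt {m : ℕ} {k : ℤ} (hk : |k| < m) : m ≠ 0 := by
  rintro rfl
  exact (abs_nonneg k).not_gt (by exact_mod_cast hk)

theorem abs_lt_mul_succ {m : ℕ} {k : ℤ} (hk : |k| < m) (j : ℕ) : |(k : ℝ)| < m * (j + 1) := by
  have hk' : |(k : ℝ)| < m := by exact_mod_cast hk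
  nlinarith [(by positivity : (0 : ℝ) ≤ m * j)]

theorem cotTerm_eq_aliasTerm {m : ℕ} {k : ℤ} (hk : |k| < m) (j : ℕ) :
    cotTerm (k / m) j = -m * (aliasTerm m k j : ℂ) := by
  have hlt := abs_lt.1 (abs_lt_mul_succ hk j)
  have hm : (m : ℂ) ≠ 0 := by exact_mod_cast ne_zero_of_abs_lt hk
  have hsub : (m * (j + 1) - k : ℂ) ≠ 0 := by
    exact_mod_cast (show (m * (j + 1) - k : ℝ) ≠ 0 by linarith)
  have hadd : (m * (j + 1) + k : ℂ) ≠ 0 := by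
    exact_mod_cast (show (m * (j + 1) + k : ℝ) ≠ 0 by linarith)
  have hleft : (k / m : ℂ) - (j + 1) = -(m * (j + 1) - k) / m := by field_simp; ring
  have hright : (k / m : ℂ) + (j + 1) = (m * (j + 1) + k) / m := by field_simp; ring
  rw [cotTerm, hleft, hright, aliasTerm]
  push_cast
  field_simp
  ring

theorem not_dvd_of_abs_lt {m : ℕ} {k : ℤ} (hk0 : k ≠ 0) (hk : |k| < m) : ¬ (m : ℤ) ∣ k :=
  fun h => hk0 (Int.eq_zero_of_abs_lt_dvd h hk)

theorem div_mem_integerComplement {m : ℕ} {k : ℤ} (hk0 : k ≠ 0) (hk : |k| < m) :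
    (k / m : ℂ) ∈ integerComplement := by
  have hm : (m : ℂ) ≠ 0 := by exact_mod_cast ne_zero_of_abs_lt hk
  rw [mem_integerComplement_iff]
  rintro ⟨l, hl⟩
  rw [eq_div_iff hm] at hl
  exact not_dvd_of_abs_lt hk0 hk ⟨l, by rw [mul_comm]; exact_mod_cast hl.symm⟩

theorem summable_aliasTerm {m : ℕ} {k : ℤ} (hk : |k| < m) : Summable (aliasTerm m k) := by
  rcases eq_or_ne k 0 with rfl | hk0
  · simpa only [funext (aliasTerm_zero m)] using summable_zero
  have hm : (m : ℂ) ≠ 0 := by exact_mod_cast ne_zero_of_abs_lt hk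
  have h := summable_cotTerm (div_mem_integerComplement hk0 hk)
  rw [funext (cotTerm_eq_aliasTerm hk), summable_mul_left_iff (neg_ne_zero.2 hm)] at h
  exact_mod_cast h

theorem pi_mul_exp_add_one_div_eq_tsum {m : ℕ} {k : ℤ} (hk0 : k ≠ 0) (hk : |k| < m) :
    I * (Real.pi * (exp (2 * Real.pi * I / m) ^ k + 1) / (exp (2 * Real.pi * I / m) ^ k - 1)) =
      m / k - m * (∑' j, aliasTerm m k j : ℝ) := by
  have hm := ne_zero_of_abs_lt hk
  have hcot := cot_series_rep' (div_mem_integerComplement hk0 hk)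
  rw [cot_pi_eq_exp_ratio, tsum_congr (cotTerm_eq_aliasTerm hk), tsum_mul_left, ← ofReal_tsum,
    show 2 * Real.pi * I * (k / m) = k * (2 * Real.pi * I / m) by ring, exp_int_mul,
    one_div_div] at hcot
  have hne := mt (exp_zpow_eq_one_iff hm k).1 (not_dvd_of_abs_lt hk0 hk)
  generalize exp (2 * Real.pi * I / m) ^ k = w at hcot hne ⊢
  have hw : w - 1 ≠ 0 := sub_ne_zero.2 hne
  have hw' : 1 - w ≠ 0 := sub_ne_zero.2 (Ne.symm hne)
  rw [sub_eq_iff_eq_add', neg_mul, ← sub_eq_add_neg] at hcot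
  rw [← hcot]
  field_simp
  linear_combination (w ^ 2 - 1) * -I_sq

theorem trapezoidalSum_exp_mul_id {m : ℕ} (hm : m ≠ 0) (k : ℤ) :
    trapezoidalSum m (fun t => exp (k * t * I) * t) = 2 * Real.pi / m *
      (2 * Real.pi / m * ∑ j ∈ Finset.range m, (j : ℂ) * (exp (2 * Real.pi * I / m) ^ k) ^ j +
        Real.pi) := by
  rw [trapezoidalSum, Finset.range_eq_Ico, Finset.sum_eq_sum_Ico_succ_bot (by omega : 0 < m),
    exp_int_mul_two_pi]
  simp only [exp_int_mul_grid, Nat.cast_zero, zero_mul, ofReal_zero, mul_zero, zero_div, zero_add,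
    Finset.mul_sum, one_mul]
  congr 2
  · refine Finset.sum_congr rfl fun j _ => ?_
    push_cast
    ring
  · push_cast
    ring

theorem trapezoidalError_id {m : ℕ} (hm : m ≠ 0) : trapezoidalError m (fun t => t) = 0 := by
  have hm' : (m : ℂ) ≠ 0 := by exact_mod_cast hm
  have hgauss : ∑ j ∈ Finset.range m, (j : ℂ) = m * (m - 1) / 2 := by
    rw [eq_div_iff two_ne_zero]
    simpa [Nat.cast_pred (Nat.pos_of_ne_zero hm)] using
      congrArg (Nat.cast : ℕ → ℂ) (Finset.sum_range_id_mul_two m)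
  have hsum := trapezoidalSum_exp_mul_id hm 0
  have hint : ∫ t in (0 : ℝ)..(2 * Real.pi), (t : ℂ) = 2 * Real.pi ^ 2 := by
    rw [intervalIntegral.integral_ofReal, integral_id]
    push_cast
    ring
  simp only [Int.cast_zero, zero_mul, exp_zero, one_mul, zpow_zero, one_pow, mul_one, hgauss]
    at hsum
  rw [trapezoidalError, hsum, hint]
  field_simp
  ring

theorem trapezoidalError_exp_mul_id {m : ℕ} {k : ℤ} (hk : |k| < m) :
    trapezoidalError m (fun t => exp (k * t * I) * t) =
      2 * Real.pi * I * (∑' j, aliasTerm m k j : ℝ) := by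
  have hm := ne_zero_of_abs_lt hk
  rcases eq_or_ne k 0 with rfl | hk0
  · simpa [aliasTerm_zero] using trapezoidalError_id hm
  have hm' : (m : ℂ) ≠ 0 := by exact_mod_cast hm
  have hne := mt (exp_zpow_eq_one_iff hm k).1 (not_dvd_of_abs_lt hk0 hk)
  have hcot := pi_mul_exp_add_one_div_eq_tsum hk0 hk
  rw [trapezoidalError, trapezoidalSum_exp_mul_id hm, integral_exp_int_mul_id hk0,
    sum_range_cast_mul_pow hne (exp_zpow_pow_eq_one hm k)]
  generalize exp (2 * Real.pi * I / m) ^ k = w at hcot hne ⊢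
  have hw : w - 1 ≠ 0 := sub_ne_zero.2 hne
  have hk' : (k : ℂ) ≠ 0 := by exact_mod_cast hk0
  calc _ = -I * (2 * Real.pi / m) * (I * (Real.pi * (w + 1) / (w - 1))) +
        2 * Real.pi * I / k := by
        field_simp
        linear_combination ((w + 1) * k * Real.pi) * I_sq
    _ = _ := by
        rw [hcot]
        field_simp
        ring

theorem trapezoidalError_exp {m : ℕ} {k : ℤ} (hk : |k| < m) :
    trapezoidalError m (fun t => exp (k * t * I)) = 0 := by
  have hm := ne_zero_of_abs_lt hk
  have hm' : (m : ℂ) ≠ 0 := by exact_mod_cast hm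
  rw [trapezoidalError, trapezoidalSum_of_periodic hm (by
      rw [exp_int_mul_two_pi, ofReal_zero, mul_zero, zero_mul, exp_zero]),
    sum_exp_int_mul_grid hm]
  rcases eq_or_ne k 0 with rfl | hk0
  · simp [hm']
  · simp [not_dvd_of_abs_lt hk0 hk, integral_exp_int_mul hk0]

/-- `(yᵏ - y⁻ᵏ) / ((yᵐ - 1) y)`, whose integral over `(1, ∞)` is the sum of the alias terms. With
`m = 2n` it equals `y⁻ⁿ (yᵏ - y⁻ᵏ) / (yⁿ - y⁻ⁿ) / y`, the contribution of the monomial `zᵏ` to the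
correction integral after folding `[ρ⁻¹, 1]` onto `[1, ρ]`. -/
noncomputable def aliasKernel (m : ℕ) (k : ℤ) (y : ℝ) : ℝ :=
  (y ^ k - y ^ (-k)) / ((y ^ m - 1) * y)

theorem aliasKernel_neg (m : ℕ) (k : ℤ) (y : ℝ) : aliasKernel m (-k) y = -aliasKernel m k y := by
  rw [aliasKernel, aliasKernel, neg_neg, ← neg_sub, neg_div]

theorem measurable_aliasKernel (m : ℕ) (k : ℤ) : Measurable (aliasKernel m k) := by
  unfold aliasKernel
  fun_prop

theorem integrableOn_Ioi_zpow_sub_one {p : ℤ} (hp : p < 0) {c : ℝ} (hc : 0 < c) :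
    IntegrableOn (fun y : ℝ => y ^ (p - 1)) (Set.Ioi c) := by
  simpa only [← Real.rpow_intCast] using
    integrableOn_Ioi_rpow_of_lt (a := ((p - 1 : ℤ) : ℝ)) (by exact_mod_cast (by omega)) hc

theorem integral_Ioi_zpow_sub_one {p : ℤ} (hp : p < 0) {c : ℝ} (hc : 0 < c) :
    ∫ y in Set.Ioi c, y ^ (p - 1) = -c ^ p / p := by
  have h := integral_Ioi_rpow_of_lt (a := ((p - 1 : ℤ) : ℝ)) (by exact_mod_cast (by omega)) hc
  simp only [Real.rpow_intCast] at h
  rw [h]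
  push_cast
  rw [sub_add_cancel, Real.rpow_intCast]

theorem abs_aliasKernel_le {m : ℕ} {k : ℤ} (hk : |k| < m) {y : ℝ} (hy : 1 < y) :
    |aliasKernel m k y| ≤ 2 * y ^ (|k| - m - 1) := by
  wlog hk0 : 0 ≤ k generalizing k
  · simpa only [aliasKernel_neg, abs_neg] using
      this (k := -k) (by rwa [abs_neg]) (by omega)
  have hy0 : 0 < y := by linarith
  have hden : 0 < y ^ m - 1 := sub_pos.2 (one_lt_pow₀ hy (ne_zero_of_abs_lt hk))
  rw [abs_of_nonneg hk0] at hk ⊢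
  have hinv : y ^ (-k) ≤ 1 := zpow_le_one_of_nonpos₀ hy.le (by omega)
  have hkm : y ^ (k - m) ≤ 1 := zpow_le_one_of_nonpos₀ hy.le (by omega)
  have hone : 1 ≤ y ^ k := one_le_zpow₀ hy.le hk0
  have hprod : y ^ (-k) * y ^ k = 1 := by rw [← zpow_add₀ hy0.ne', neg_add_cancel, zpow_zero]
  have hnum : 0 ≤ y ^ k - y ^ (-k) := by linarith
  rw [aliasKernel, abs_of_nonneg (by positivity), div_le_iff₀ (by positivity)]
  calc y ^ k - y ^ (-k) = (y ^ k - 1) * (1 + y ^ (-k)) := by linear_combination -hprod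
    _ ≤ (y ^ k - y ^ (k - m)) * 2 := by gcongr <;> linarith
    _ = 2 * y ^ (k - m - 1) * ((y ^ m - 1) * y) := by
      rw [zpow_sub_one₀ hy0.ne', zpow_sub₀ hy0.ne', zpow_natCast]
      field_simp

theorem ae_norm_aliasKernel_le {m : ℕ} {k : ℤ} (hk : |k| < m) {c : ℝ} (hc : 1 ≤ c) :
    ∀ᵐ y ∂volume.restrict (Set.Ioi c), ‖aliasKernel m k y‖ ≤ 2 * y ^ (|k| - m - 1) :=
  (ae_restrict_iff' measurableSet_Ioi).2
    (ae_of_all _ fun _ hy => abs_aliasKernel_le hk (hc.trans_lt hy))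

theorem integrableOn_aliasKernel {m : ℕ} {k : ℤ} (hk : |k| < m) {c : ℝ} (hc : 1 ≤ c) :
    IntegrableOn (aliasKernel m k) (Set.Ioi c) :=
  ((integrableOn_Ioi_zpow_sub_one (p := |k| - m) (by omega) (zero_lt_one.trans_le hc)).const_mul
    2).mono' (measurable_aliasKernel m k).aestronglyMeasurable (ae_norm_aliasKernel_le hk hc)

theorem abs_integral_Ioi_aliasKernel_le {m : ℕ} {k : ℤ} (hk : |k| < m) {ρ : ℝ} (hρ : 1 ≤ ρ) :
    |∫ y in Set.Ioi ρ, aliasKernel m k y| ≤ 2 * ρ ^ (|k| - m) := by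
  have hρ0 : 0 < ρ := zero_lt_one.trans_le hρ
  have hgap : (1 : ℝ) ≤ m - |k| := by
    have : |k| + 1 ≤ (m : ℤ) := by omega
    rw [le_sub_iff_add_le']
    exact_mod_cast this
  rw [← Real.norm_eq_abs]
  calc ‖∫ y in Set.Ioi ρ, aliasKernel m k y‖ ≤ ∫ y in Set.Ioi ρ, 2 * y ^ (|k| - m - 1) :=
        norm_integral_le_of_norm_le
          ((integrableOn_Ioi_zpow_sub_one (p := |k| - m) (by omega) hρ0).const_mul 2)
          (ae_norm_aliasKernel_le hk hρ)
    _ = 2 * (ρ ^ (|k| - m) / (m - |k|)) := by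
        rw [integral_const_mul, integral_Ioi_zpow_sub_one (by omega) hρ0]
        push_cast
        rw [neg_div, ← div_neg, neg_sub]
    _ ≤ 2 * ρ ^ (|k| - m) := by
        gcongr
        exact div_le_self (by positivity) hgap

theorem hasSum_aliasKernel {m : ℕ} (hm : m ≠ 0) (k : ℤ) {y : ℝ} (hy : 1 < y) :
    HasSum (fun j : ℕ => y ^ (k - m * (j + 1) - 1) - y ^ (-k - m * (j + 1) - 1))
      (aliasKernel m k y) := by
  have hy0 : y ≠ 0 := by linarith
  have hlt : (y ^ m)⁻¹ < 1 := inv_lt_one_of_one_lt₀ (one_lt_pow₀ hy hm)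
  have hden : y ^ m - 1 ≠ 0 := (sub_pos.2 (one_lt_pow₀ hy hm)).ne'
  have hval : aliasKernel m k y =
      (y ^ k - y ^ (-k)) * y⁻¹ * (y ^ m)⁻¹ * (1 - (y ^ m)⁻¹)⁻¹ := by
    rw [aliasKernel]
    field_simp
  rw [hval]
  refine ((hasSum_geometric_of_lt_one (by positivity) hlt).mul_left _).congr_fun fun j => ?_
  have hpow : ∀ l : ℤ, y ^ (l - m * (j + 1) - 1) = y ^ l * y⁻¹ * (y ^ m)⁻¹ * (y ^ m)⁻¹ ^ j := by
    intro l
    rw [zpow_sub_one₀ hy0, zpow_sub₀ hy0, zpow_mul, zpow_natCast, zpow_add_one₀ (by positivity),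
      zpow_natCast, inv_pow]
    field_simp
  rw [hpow, hpow]
  ring

theorem integral_Ioi_one_sub_zpow_eq_aliasTerm {m : ℕ} {k : ℤ} (hk : |k| < m) (j : ℕ) :
    ∫ y in Set.Ioi (1 : ℝ), (y ^ (k - m * (j + 1) - 1) - y ^ (-k - m * (j + 1) - 1)) =
      aliasTerm m k j := by
  have hlt := abs_lt.1 (show |k| < m * (j + 1) by exact_mod_cast abs_lt_mul_succ hk j)
  rw [integral_sub
    (integrableOn_Ioi_zpow_sub_one (p := k - m * (j + 1)) (by omega) one_pos)
    (integrableOn_Ioi_zpow_sub_one (by omega) one_pos),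
    integral_Ioi_zpow_sub_one (by omega) one_pos, integral_Ioi_zpow_sub_one (by omega) one_pos,
    one_zpow, one_zpow, aliasTerm]
  push_cast
  rw [neg_div, ← div_neg, neg_div, ← div_neg]
  ring_nf

theorem tsum_aliasTerm {m : ℕ} {k : ℤ} (hk : |k| < m) :
    ∑' j, aliasTerm m k j = ∫ y in Set.Ioi (1 : ℝ), aliasKernel m k y := by
  wlog hk0 : 0 ≤ k generalizing k
  · simpa only [aliasKernel_neg, aliasTerm_neg, tsum_neg, integral_neg, neg_inj] using
      this (k := -k) (by rwa [abs_neg]) (by omega)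
  have hlt : ∀ j : ℕ, |k| < m * (j + 1) := fun j => by exact_mod_cast abs_lt_mul_succ hk j
  rw [abs_of_nonneg hk0] at hlt
  have hnorm : ∀ j : ℕ, ∫ y in Set.Ioi (1 : ℝ),
      ‖y ^ (k - m * (j + 1) - 1) - y ^ (-k - m * (j + 1) - 1)‖ = aliasTerm m k j := by
    intro j
    rw [← integral_Ioi_one_sub_zpow_eq_aliasTerm hk]
    refine setIntegral_congr_fun measurableSet_Ioi fun y hy => Real.norm_of_nonneg ?_
    exact sub_nonneg.2 (zpow_le_zpow_right₀ (Set.mem_Ioi.1 hy).le (by omega))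
  have hint : ∀ j : ℕ, IntegrableOn
      (fun y : ℝ => y ^ (k - m * (j + 1) - 1) - y ^ (-k - m * (j + 1) - 1)) (Set.Ioi 1) := by
    intro j
    have := hlt j
    exact (integrableOn_Ioi_zpow_sub_one (by omega) one_pos).sub
      (integrableOn_Ioi_zpow_sub_one (by omega) one_pos)
  have hsum := hasSum_integral_of_summable_integral_norm hint
    (by simpa only [hnorm] using summable_aliasTerm hk)
  simp only [integral_Ioi_one_sub_zpow_eq_aliasTerm hk] at hsum
  rw [hsum.tsum_eq]
  exact setIntegral_congr_fun measurableSet_Ioi fun y hy =>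
    (hasSum_aliasKernel (ne_zero_of_abs_lt hk) k hy).tsum_eq

theorem fourierCoeffOn_sub_linear {w : ℝ → ℂ} (hw : ContinuousOn w (Set.Icc 0 (2 * Real.pi)))
    (a d : ℂ) {s : ℤ} (hs : s ≠ 0) :
    fourierCoeffOn Real.two_pi_pos (fun t => w t - (a + d * t)) s =
      fourierCoeffOn Real.two_pi_pos w s - d * (I / s) := by
  have hconst := integral_exp_int_mul (neg_ne_zero.2 hs)
  have hid := integral_exp_int_mul_id (neg_ne_zero.2 hs)
  push_cast at hconst hid
  simp only [neg_mul] at hconst hid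
  have hint : IntervalIntegrable (fun t : ℝ => exp (-(s * t * I)) * w t) volume 0
      (2 * Real.pi) := by
    refine ContinuousOn.intervalIntegrable ?_
    rw [Set.uIcc_of_le Real.two_pi_pos.le]
    exact (by fun_prop : Continuous fun t : ℝ => exp (-(s * t * I))).continuousOn.mul hw
  have hlin : ∫ t in (0 : ℝ)..(2 * Real.pi),
      (a * exp (-(s * t * I)) + d * (exp (-(s * t * I)) * t)) = d * (2 * Real.pi * I / s) := by
    rw [intervalIntegral.integral_add (Continuous.intervalIntegrable (by fun_prop) _ _)
      (Continuous.intervalIntegrable (by fun_prop) _ _), intervalIntegral.integral_const_mul,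
      intervalIntegral.integral_const_mul, hconst, hid, mul_zero, zero_add, div_neg, neg_neg]
  have hsplit : ∀ t : ℝ, exp (-(s * t * I)) * (w t - (a + d * t)) =
      exp (-(s * t * I)) * w t -
        (a * exp (-(s * t * I)) + d * (exp (-(s * t * I)) * t)) := fun t => by ring
  rw [fourierCoeffOn_two_pi, fourierCoeffOn_two_pi]
  simp only [hsplit]
  rw [intervalIntegral.integral_sub hint (Continuous.intervalIntegrable (by fun_prop) _ _), hlin,
    mul_sub]
  congr 1
  field_simp

theorem trapezoidalError_exp_mul_eq {w : ℝ → ℂ} (hw : ContinuousOn w (Set.Icc 0 (2 * Real.pi)))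
    (a d : ℂ) {m : ℕ} {k : ℤ} (hk : |k| < m) :
    trapezoidalError m (fun t => exp (k * t * I) * w t) =
      trapezoidalError m (fun t => exp (k * t * I) * (w t - (a + d * t))) +
        d * (2 * Real.pi * I * (∫ y in Set.Ioi (1 : ℝ), aliasKernel m k y : ℝ)) := by
  have hsplit : ∀ t : ℝ, exp (k * t * I) * w t = exp (k * t * I) * (w t - (a + d * t)) +
      (a * exp (k * t * I) + d * (exp (k * t * I) * t)) := fun t => by ring
  have hint : IntervalIntegrable (fun t : ℝ => exp (k * t * I) * (w t - (a + d * t))) volume 0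
      (2 * Real.pi) := by
    refine ContinuousOn.intervalIntegrable ?_
    rw [Set.uIcc_of_le Real.two_pi_pos.le]
    fun_prop
  simp only [hsplit]
  rw [trapezoidalError_add hint (Continuous.intervalIntegrable (by fun_prop) _ _),
    trapezoidalError_add (Continuous.intervalIntegrable (by fun_prop) _ _)
      (Continuous.intervalIntegrable (by fun_prop) _ _),
    trapezoidalError_const_mul, trapezoidalError_const_mul, trapezoidalError_exp hk,
    trapezoidalError_exp_mul_id hk, tsum_aliasTerm hk, mul_zero, zero_add]

theorem exists_norm_trapezoidalError_exp_mul_sub_le {w : ℝ → ℂ}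
    (hw : ContinuousOn w (Set.Icc 0 (2 * Real.pi))) {α : ℝ} (hα : 1 < α)
    (hdecay : (fun s : ℤ => fourierCoeffOn Real.two_pi_pos w s -
        (w (2 * Real.pi) - w 0) / (2 * Real.pi) * (I / s))
      =O[cofinite] fun s => |(s : ℝ)| ^ (-α)) :
    ∃ C, ∀ᶠ m : ℕ in atTop, ∀ k : ℤ, 2 * |k| ≤ m →
      ‖trapezoidalError m (fun t => exp (k * t * I) * w t) -
        (w (2 * Real.pi) - w 0) * I * (∫ y in Set.Ioi (1 : ℝ), aliasKernel m k y : ℝ)‖ ≤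
          C * (m : ℝ) ^ (-α) := by
  obtain ⟨d, hd⟩ : ∃ d, d = (w (2 * Real.pi) - w 0) / (2 * Real.pi) := ⟨_, rfl⟩
  have hd' : d * (2 * Real.pi) = w (2 * Real.pi) - w 0 := by
    rw [hd, div_mul_cancel₀ _ (by simp [Real.pi_ne_zero])]
  have hper : w 0 - (w 0 + d * ((0 : ℝ) : ℂ)) =
      w (2 * Real.pi) - (w 0 + d * ((2 * Real.pi : ℝ) : ℂ)) := by
    push_cast
    linear_combination hd'
  have hlin : fourierCoeffOn Real.two_pi_pos (fun t => w t - (w 0 + d * t)) =O[cofinite]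
      fun s : ℤ => |(s : ℝ)| ^ (-α) := by
    refine hdecay.congr' ?_ .rfl
    filter_upwards [(Set.finite_singleton (0 : ℤ)).compl_mem_cofinite] with s hs
    rw [fourierCoeffOn_sub_linear hw _ _ hs, hd]
  obtain ⟨C, hC⟩ := exists_norm_trapezoidalError_exp_mul_le (by fun_prop) hper hα hlin
  refine ⟨C, ?_⟩
  filter_upwards [hC, eventually_gt_atTop 0] with m hm hm0 k hk
  rw [trapezoidalError_exp_mul_eq hw (w 0) d (by omega), ← hd']
  convert hm k hk using 2
  ring

/-! ### Truncated Laurent series -/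

theorem sum_Icc_neg_eq_sum_Ioo_add {G : Type*} [AddCommMonoid G] (f : ℤ → G) {n : ℕ} (hn : n ≠ 0) :
    ∑ k ∈ Finset.Icc (-n : ℤ) n, f k = f (-n) + ∑ k ∈ Finset.Ioo (-n : ℤ) n, f k + f n := by
  rw [← Finset.Ico_insert_right (by omega), ← Finset.Ioo_insert_left (by omega),
    Finset.sum_insert (by simp [hn]), Finset.sum_insert (by simp), add_comm]

theorem sum_Icc_neg_eq_sum_range_add {G : Type*} [AddCommMonoid G] (f : ℤ → G) (n : ℕ) :
    ∑ k ∈ Finset.Icc (-n : ℤ) n, f k =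
      ∑ j ∈ Finset.range (n + 1), f j + ∑ j ∈ Finset.range n, f (-(j + 1)) := by
  induction n with
  | zero => simp
  | succ n ih =>
    have hIoo : Finset.Ioo (-(n + 1 : ℕ) : ℤ) (n + 1 : ℕ) = Finset.Icc (-n : ℤ) n := by
      ext k
      simp only [Finset.mem_Ioo, Finset.mem_Icc]
      omega
    rw [sum_Icc_neg_eq_sum_Ioo_add f n.succ_ne_zero, hIoo, ih, Finset.sum_range_succ _ (n + 1),
      Finset.sum_range_succ (fun j : ℕ => f (-(j + 1))) n]
    push_cast
    abel

theorem tsum_int_eq_sum_Icc_add {G : Type*} [AddCommGroup G] [UniformSpace G] [IsUniformAddGroup G]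
    [CompleteSpace G] [T2Space G] {f : ℤ → G} (hf : Summable f) (n : ℕ) :
    ∑' k, f k = ∑ k ∈ Finset.Icc (-n : ℤ) n, f k + ∑' j : ℕ, f (n + 1 + j) +
      ∑' j : ℕ, f (-(n + 1 + j)) := by
  obtain ⟨hpos, hneg⟩ := summable_int_iff_summable_nat_and_neg_add_zero.1 hf
  rw [tsum_of_nat_of_neg_add_one hpos hneg, sum_Icc_neg_eq_sum_range_add,
    ← hpos.sum_add_tsum_nat_add (n + 1), ← hneg.sum_add_tsum_nat_add n]
  have hplus : ∀ j : ℕ, ((j + (n + 1) : ℕ) : ℤ) = n + 1 + j := by intro j; omega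
  have hminus : ∀ j : ℕ, -(((j + n : ℕ) : ℤ) + 1) = -(n + 1 + j) := by intro j; omega
  simp only [hplus, hminus]
  abel

theorem eq_laurentMid_add {K : ℂ → ℂ} {n : ℕ} (hn : n ≠ 0) {z : ℂ}
    (hK : HasSum (fun k : ℤ => laurentCoeff K k * z ^ k) (K z)) :
    K z = laurentMid K n z + laurentPlus K n z + laurentMinus K n z := by
  rw [← hK.tsum_eq, tsum_int_eq_sum_Icc_add hK.summable n, sum_Icc_neg_eq_sum_Ioo_add _ hn,
    laurentMid, laurentPlus, laurentMinus, zpow_natCast]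
  ring

/-- The coefficients of the Laurent polynomial `laurentMid K n`: the Laurent coefficients of `K`,
those of index `±n` being halved. -/
noncomputable def midCoeff (K : ℂ → ℂ) (n : ℕ) (k : ℤ) : ℂ :=
  if |k| = n then 1 / 2 * laurentCoeff K k else laurentCoeff K k

theorem norm_midCoeff_le (K : ℂ → ℂ) (n : ℕ) (k : ℤ) : ‖midCoeff K n k‖ ≤ ‖laurentCoeff K k‖ := by
  rw [midCoeff]
  split_ifs
  · rw [norm_mul]
    exact mul_le_of_le_one_left (norm_nonneg _) (by norm_num)
  · exact le_rfl

theorem laurentMid_eq_sum (K : ℂ → ℂ) {n : ℕ} (hn : n ≠ 0) (z : ℂ) :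
    laurentMid K n z = ∑ k ∈ Finset.Icc (-n : ℤ) n, midCoeff K n k * z ^ k := by
  have hinner : ∀ k ∈ Finset.Ioo (-n : ℤ) n, midCoeff K n k = laurentCoeff K k :=
    fun k hk => if_neg (abs_lt.2 (Finset.mem_Ioo.1 hk)).ne
  rw [sum_Icc_neg_eq_sum_Ioo_add _ hn, Finset.sum_congr rfl fun k hk => by rw [hinner k hk],
    midCoeff, midCoeff, if_pos (by simp), if_pos (by simp), laurentMid, zpow_natCast]

theorem continuousOn_laurentMid (K : ℂ → ℂ) (n : ℕ) : ContinuousOn (laurentMid K n) {0}ᶜ := by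
  have hpow : ∀ (c : ℂ) (k : ℤ), ContinuousOn (fun z : ℂ => c * z ^ k) {0}ᶜ := fun c k =>
    continuousOn_const.mul (continuousOn_id.zpow₀ k fun z hz => Or.inl hz)
  exact ((hpow _ _).add (continuousOn_finsetSum _ fun k _ => hpow _ k)).add (by fun_prop)

/-- The tail `½ aₙ zⁿ + ∑_{k > n} aₖ zᵏ` of a power series. Both `laurentPlus` and, in the variable
`z⁻¹`, `laurentMinus` are of this form. -/
noncomputable def halfTail (a : ℕ → ℂ) (n : ℕ) (z : ℂ) : ℂ :=
  1 / 2 * a n * z ^ n + ∑' j : ℕ, a (n + 1 + j) * z ^ (n + 1 + j)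

theorem laurentPlus_eq_halfTail (K : ℂ → ℂ) (n : ℕ) :
    laurentPlus K n = halfTail (fun k => laurentCoeff K k) n := by
  ext z
  rw [laurentPlus, halfTail]
  congr! 3

theorem laurentMinus_eq_halfTail (K : ℂ → ℂ) (n : ℕ) (z : ℂ) :
    laurentMinus K n z = halfTail (fun k => laurentCoeff K (-k)) n z⁻¹ := by
  rw [laurentMinus, halfTail, add_comm, zpow_neg, zpow_natCast, inv_pow]
  congr! 3 with j
  rw [← zpow_natCast, inv_zpow, zpow_neg]
  push_cast
  rfl

section HalfTail

variable {a : ℕ → ℂ} {M q : ℝ}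

theorem norm_mul_pow_le (ha : ∀ k, ‖a k‖ ≤ M * q ^ k) (k : ℕ) {z : ℂ} (hz : ‖z‖ ≤ 1) :
    ‖a k * z ^ k‖ ≤ M * q ^ k := by
  rw [norm_mul, norm_pow]
  exact (mul_le_of_le_one_right (norm_nonneg _) (pow_le_one₀ (norm_nonneg z) hz)).trans (ha k)

theorem hasSum_mul_pow_add (hq₀ : 0 ≤ q) (hq₁ : q < 1) (n : ℕ) :
    HasSum (fun j : ℕ => M * q ^ (n + j)) (M * q ^ n * (1 - q)⁻¹) := by
  simpa only [pow_add, mul_assoc] using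
    ((hasSum_geometric_of_lt_one hq₀ hq₁).mul_left (q ^ n)).mul_left M

theorem norm_halfTail_le (ha : ∀ k, ‖a k‖ ≤ M * q ^ k) (hq₀ : 0 ≤ q) (hq₁ : q < 1) (n : ℕ)
    {z : ℂ} (hz : ‖z‖ ≤ 1) : ‖halfTail a n z‖ ≤ M / (1 - q) * q ^ n := by
  have hhead : ‖1 / 2 * a n * z ^ n‖ ≤ M * q ^ n := by
    rw [mul_assoc, norm_mul]
    exact (mul_le_of_le_one_left (norm_nonneg _) (by norm_num)).trans (norm_mul_pow_le ha n hz)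
  have htail : ‖∑' j : ℕ, a (n + 1 + j) * z ^ (n + 1 + j)‖ ≤ M * q ^ (n + 1) * (1 - q)⁻¹ :=
    tsum_of_norm_bounded (hasSum_mul_pow_add hq₀ hq₁ (n + 1)) fun j => norm_mul_pow_le ha _ hz
  have : 1 - q ≠ 0 := by linarith
  calc ‖halfTail a n z‖ ≤ M * q ^ n + M * q ^ (n + 1) * (1 - q)⁻¹ := norm_add_le_of_le hhead htail
    _ = M / (1 - q) * q ^ n := by
      field_simp
      ring

theorem continuousOn_halfTail (ha : ∀ k, ‖a k‖ ≤ M * q ^ k) (hq₀ : 0 ≤ q) (hq₁ : q < 1) (n : ℕ) :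
    ContinuousOn (halfTail a n) (Metric.closedBall 0 1) :=
  ContinuousOn.add (by fun_prop) (continuousOn_tsum (fun j => by fun_prop)
    (hasSum_mul_pow_add hq₀ hq₁ (n + 1)).summable fun j _ hz =>
      norm_mul_pow_le ha _ (by simpa using hz))

end HalfTail

section LaurentTails

variable {K : ℂ → ℂ} {M q : ℝ}

theorem norm_laurentPlus_le (hc : ∀ k, ‖laurentCoeff K k‖ ≤ M * q ^ k.natAbs) (hq₀ : 0 ≤ q)
    (hq₁ : q < 1) (n : ℕ) {z : ℂ} (hz : ‖z‖ ≤ 1) :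
    ‖laurentPlus K n z‖ ≤ M / (1 - q) * q ^ n := by
  rw [laurentPlus_eq_halfTail]
  exact norm_halfTail_le (fun k => by simpa using hc k) hq₀ hq₁ n hz

theorem norm_laurentMinus_le (hc : ∀ k, ‖laurentCoeff K k‖ ≤ M * q ^ k.natAbs) (hq₀ : 0 ≤ q)
    (hq₁ : q < 1) (n : ℕ) {z : ℂ} (hz : 1 ≤ ‖z‖) :
    ‖laurentMinus K n z‖ ≤ M / (1 - q) * q ^ n := by
  rw [laurentMinus_eq_halfTail]
  refine norm_halfTail_le (fun k => by simpa using hc (-k)) hq₀ hq₁ n ?_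
  rw [norm_inv]
  exact inv_le_one_of_one_le₀ hz

theorem continuousOn_laurentPlus (hc : ∀ k, ‖laurentCoeff K k‖ ≤ M * q ^ k.natAbs) (hq₀ : 0 ≤ q)
    (hq₁ : q < 1) (n : ℕ) : ContinuousOn (laurentPlus K n) (Metric.closedBall 0 1) := by
  rw [laurentPlus_eq_halfTail]
  exact continuousOn_halfTail (fun k => by simpa using hc k) hq₀ hq₁ n

theorem continuousOn_laurentMinus (hc : ∀ k, ‖laurentCoeff K k‖ ≤ M * q ^ k.natAbs) (hq₀ : 0 ≤ q)
    (hq₁ : q < 1) (n : ℕ) : ContinuousOn (laurentMinus K n) {z | 1 ≤ ‖z‖} := by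
  rw [funext (laurentMinus_eq_halfTail K n)]
  refine (continuousOn_halfTail (fun k => by simpa using hc (-k)) hq₀ hq₁ n).comp
    (continuousOn_inv₀.mono fun z hz => ?_) fun z hz => ?_
  · exact norm_pos_iff.1 (zero_lt_one.trans_le hz)
  · simpa using inv_le_one_of_one_le₀ hz

end LaurentTails

/-! ### Principal values -/

theorem IsPrincipalValue.const_mul {F : ℝ → ℂ} {a c b : ℝ} {J : ℂ} (h : IsPrincipalValue F a c b J)
    (d : ℂ) : IsPrincipalValue (fun x => d * F x) a c b (d * J) := by
  refine ⟨h.1.mono fun ε hε => ⟨hε.1.const_mul d, hε.2.const_mul d⟩, ?_⟩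
  simpa only [intervalIntegral.integral_const_mul, ← mul_add] using h.2.const_mul d

theorem integral_eq_integral_comp_inv {f : ℝ → ℂ} {a b : ℝ} (ha : 0 < a) (hab : a ≤ b)
    (hf : ContinuousOn f (Set.Icc a b)) :
    ∫ x in a..b, f x = ∫ y in b⁻¹..a⁻¹, ((y ^ 2)⁻¹ : ℝ) * f y⁻¹ := by
  have hb : 0 < b := ha.trans_le hab
  have huIcc : Set.uIcc b⁻¹ a⁻¹ = Set.Icc b⁻¹ a⁻¹ := Set.uIcc_of_le (inv_anti₀ ha hab)
  have hpos : ∀ y ∈ Set.Icc b⁻¹ a⁻¹, y ≠ 0 := fun y hy => ((inv_pos.2 hb).trans_le hy.1).ne'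
  have hmaps : Set.MapsTo (fun y : ℝ => y⁻¹) (Set.Icc b⁻¹ a⁻¹) (Set.Icc a b) := fun y hy =>
    have hy₀ : 0 < y := (inv_pos.2 hb).trans_le hy.1
    ⟨(le_inv_comm₀ hy₀ ha).1 hy.2, (inv_le_comm₀ hb hy₀).1 hy.1⟩
  have h := intervalIntegral.integral_deriv_smul_comp'' (a := b⁻¹) (b := a⁻¹) (g := f)
    (f := fun y : ℝ => y⁻¹) (f' := fun y : ℝ => -(y ^ 2)⁻¹)
    (huIcc ▸ continuousOn_inv₀.mono hpos)
    (fun y hy => (hasDerivAt_inv (hpos y (huIcc ▸ Set.Ioo_subset_Icc_self hy))).hasDerivWithinAt)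
    (huIcc ▸ ((continuousOn_pow 2).inv₀ fun y hy => pow_ne_zero 2 (hpos y hy)).neg)
    (hf.mono (huIcc ▸ hmaps.image_subset))
  rw [inv_inv, inv_inv, intervalIntegral.integral_symm a b, ← neg_eq_iff_eq_neg] at h
  rw [← h, ← intervalIntegral.integral_neg]
  simp only [Function.comp_apply, real_smul, ofReal_neg, neg_mul, neg_neg]

theorem one_add_le_inv_one_sub {ε : ℝ} (hε : ε < 1) : 1 + ε ≤ (1 - ε)⁻¹ := by
  rw [← one_div, le_div_iff₀ (by linarith)]
  nlinarith [sq_nonneg ε]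

theorem tendsto_inv_one_sub : Tendsto (fun ε : ℝ => (1 - ε)⁻¹) (𝓝[>] 0) (𝓝 1) := by
  have h : ContinuousAt (fun ε : ℝ => (1 - ε)⁻¹) 0 :=
    (continuousAt_const.sub continuousAt_id).inv₀ (by simp)
  simpa using h.tendsto.mono_left nhdsWithin_le_nhds

/-- The interval is of length `O(ε²)`, and the integrand is `O(1/ε)` there. -/
theorem tendsto_integral_one_add_inv_one_sub {f : ℝ → ℂ}
    (hf : f =O[𝓝[>] 1] fun y => (y - 1)⁻¹) :
    Tendsto (fun ε : ℝ => ∫ y in (1 + ε)..(1 - ε)⁻¹, f y) (𝓝[>] 0) (𝓝 0) := by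
  obtain ⟨C, hC₀, hC⟩ := hf.exists_nonneg
  obtain ⟨δ, hδ, hδC⟩ := (mem_nhdsGT_iff_exists_Ioo_subset).1 hC.bound
  have hO : (fun ε : ℝ => ∫ y in (1 + ε)..(1 - ε)⁻¹, f y) =O[𝓝[>] 0] fun ε => ε := by
    refine IsBigO.of_bound (C * 2) ?_
    filter_upwards [Ioo_mem_nhdsGT (show (0 : ℝ) < 1 / 2 by norm_num),
      tendsto_inv_one_sub.eventually_lt_const hδ] with ε ⟨hε₀, hε₁⟩ hεδ
    have hle : 1 + ε ≤ (1 - ε)⁻¹ := one_add_le_inv_one_sub (by linarith)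
    have hbound : ∀ y ∈ Set.uIoc (1 + ε) (1 - ε)⁻¹, ‖f y‖ ≤ C * ε⁻¹ := by
      intro y hy
      rw [Set.uIoc_of_le hle] at hy
      have hy₁ : ε ≤ y - 1 := by linarith [hy.1]
      refine (hδC ⟨by linarith, hy.2.trans_lt hεδ⟩).trans ?_
      rw [Real.norm_of_nonneg (inv_nonneg.2 (hε₀.le.trans hy₁))]
      gcongr
    have hne : 1 - ε ≠ 0 := by linarith
    have hinv : (1 - ε)⁻¹ ≤ 2 := inv_le_of_inv_le₀ two_pos (by linarith)
    calc ‖∫ y in (1 + ε)..(1 - ε)⁻¹, f y‖ ≤ C * ε⁻¹ * |(1 - ε)⁻¹ - (1 + ε)| :=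
          intervalIntegral.norm_integral_le_of_norm_le_const hbound
      _ = C * (1 - ε)⁻¹ * ε := by
          rw [abs_of_nonneg (sub_nonneg.2 hle)]
          field_simp
          ring
      _ ≤ C * 2 * ‖ε‖ := by
          rw [Real.norm_of_nonneg hε₀.le]
          gcongr
  exact hO.trans_tendsto (tendsto_id.mono_left nhdsWithin_le_nhds)

theorem continuousOn_inv_sq_mul_comp_inv {F : ℝ → ℂ} {ρ : ℝ}
    (hF : ContinuousOn F (Set.Ico ρ⁻¹ 1)) :
    ContinuousOn (fun y => ((y ^ 2)⁻¹ : ℝ) * F y⁻¹) (Set.Ioc 1 ρ) := by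
  have hne : ∀ y ∈ Set.Ioc 1 ρ, y ≠ 0 := fun y hy => (zero_lt_one.trans hy.1).ne'
  have hmaps : Set.MapsTo (fun y : ℝ => y⁻¹) (Set.Ioc 1 ρ) (Set.Ico ρ⁻¹ 1) := fun y hy =>
    ⟨inv_anti₀ (zero_lt_one.trans hy.1) hy.2, inv_lt_one_of_one_lt₀ hy.1⟩
  exact (continuous_ofReal.comp_continuousOn
    ((continuousOn_pow 2).inv₀ fun y hy => pow_ne_zero 2 (hne y hy))).mul
      (hF.comp (continuousOn_inv₀.mono hne) hmaps)

theorem integral_add_integral_eq_of_continuousOn {F : ℝ → ℂ} {ρ ε : ℝ}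
    (hleft : ContinuousOn F (Set.Ico ρ⁻¹ 1)) (hright : ContinuousOn F (Set.Ioc 1 ρ))
    (hε₀ : 0 < ε) (hε₁ : ε < 1) (hερ : (1 - ε)⁻¹ < ρ) :
    (∫ x in ρ⁻¹..(1 - ε), F x) + ∫ x in (1 + ε)..ρ, F x =
      (∫ y in (1 + ε)..(1 - ε)⁻¹, F y) +
        ∫ y in (1 - ε)⁻¹..ρ, (F y + ((y ^ 2)⁻¹ : ℝ) * F y⁻¹) := by
  have hle : 1 + ε ≤ (1 - ε)⁻¹ := one_add_le_inv_one_sub hε₁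
  have hρ : 0 < ρ := by linarith
  have hint : ∀ {g : ℝ → ℂ}, ContinuousOn g (Set.Ioc 1 ρ) → ∀ {a b : ℝ}, 1 < a → a ≤ b → b ≤ ρ →
      IntervalIntegrable g volume a b := fun hg _ _ ha hab hb =>
    (hg.mono (Set.uIcc_of_le hab ▸ fun _ hy =>
      ⟨ha.trans_le hy.1, hy.2.trans hb⟩)).intervalIntegrable
  have hsubst := integral_eq_integral_comp_inv (inv_pos.2 hρ)
    ((inv_lt_comm₀ (by linarith) hρ).1 hερ).le
    (hleft.mono fun _ hx => ⟨hx.1, hx.2.trans_lt (by linarith)⟩)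
  rw [hsubst, inv_inv, intervalIntegral.integral_add (hint hright (by linarith) hερ.le le_rfl)
    (hint (continuousOn_inv_sq_mul_comp_inv hleft) (by linarith) hερ.le le_rfl),
    ← intervalIntegral.integral_add_adjacent_intervals (hint hright (by linarith) hle hερ.le)
      (hint hright (by linarith) hερ.le le_rfl)]
  ring

/-- Fold `[ρ⁻¹, 1]` onto `[1, ρ]` by `x ↦ x⁻¹`: the cut-out intervals do not match exactly, but the
difference tends to `0`. -/
theorem isPrincipalValue_of_continuousOn {F : ℝ → ℂ} {ρ : ℝ} (hρ : 1 < ρ)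
    (hleft : ContinuousOn F (Set.Ico ρ⁻¹ 1)) (hright : ContinuousOn F (Set.Ioc 1 ρ))
    (hF : F =O[𝓝[>] 1] fun y => (y - 1)⁻¹)
    (hfold : IntervalIntegrable (fun y => F y + ((y ^ 2)⁻¹ : ℝ) * F y⁻¹) volume 1 ρ) :
    IsPrincipalValue F ρ⁻¹ 1 ρ (∫ y in (1 : ℝ)..ρ, (F y + ((y ^ 2)⁻¹ : ℝ) * F y⁻¹)) := by
  have hev : ∀ᶠ ε in 𝓝[>] (0 : ℝ), ε ∈ Set.Ioo 0 1 ∧ (1 - ε)⁻¹ < ρ :=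
    (show ∀ᶠ ε in 𝓝[>] (0 : ℝ), ε ∈ Set.Ioo 0 1 from Ioo_mem_nhdsGT one_pos).and
      (tendsto_inv_one_sub.eventually_lt_const hρ)
  refine ⟨hev.mono fun ε ⟨⟨hε₀, hε₁⟩, hερ⟩ => ⟨?_, ?_⟩, ?_⟩
  · have hle : ρ⁻¹ ≤ 1 - ε := ((inv_lt_comm₀ (by linarith) (by linarith)).1 hερ).le
    exact (hleft.mono (Set.uIcc_of_le hle ▸ fun _ hx =>
      ⟨hx.1, hx.2.trans_lt (by linarith)⟩)).intervalIntegrable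
  · have hle : 1 + ε ≤ ρ := (one_add_le_inv_one_sub hε₁).trans hερ.le
    exact (hright.mono (Set.uIcc_of_le hle ▸ fun _ hx =>
      ⟨by linarith [hx.1], hx.2⟩)).intervalIntegrable
  · have hlim : Tendsto (fun ε : ℝ => ∫ y in (1 - ε)⁻¹..ρ, (F y + ((y ^ 2)⁻¹ : ℝ) * F y⁻¹))
        (𝓝[>] 0) (𝓝 (∫ y in (1 : ℝ)..ρ, (F y + ((y ^ 2)⁻¹ : ℝ) * F y⁻¹))) := by
      have hcont := intervalIntegral.continuousOn_primitive_interval_left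
        ((intervalIntegrable_iff' (by finiteness)).1 hfold)
      refine (hcont 1 Set.left_mem_uIcc).tendsto.comp
        (tendsto_nhdsWithin_iff.2 ⟨tendsto_inv_one_sub, hev.mono fun ε ⟨⟨hε₀, hε₁⟩, hερ⟩ => ?_⟩)
      exact Set.mem_uIcc_of_le (by linarith [one_add_le_inv_one_sub hε₁]) hερ.le
    have hsum := (tendsto_integral_one_add_inv_one_sub hF).add hlim
    rw [zero_add] at hsum
    exact hsum.congr' (hev.mono fun ε ⟨⟨hε₀, hε₁⟩, hερ⟩ =>
      (integral_add_integral_eq_of_continuousOn hleft hright hε₀ hε₁ hερ).symm)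

/-! ### The correction integral -/

theorem exists_norm_laurentCoeff_le_and_hasSum {K : ℂ → ℂ} {ρ : ℝ} (hρ : 1 ≤ ρ)
    (hK : AnalyticOnNhd ℂ K (annulus ρ)) :
    ∃ M q : ℝ, 0 < q ∧ q < 1 ∧ (∀ k, ‖laurentCoeff K k‖ ≤ M * q ^ k.natAbs) ∧
      ∀ z ∈ annulus ρ, HasSum (fun k : ℤ => laurentCoeff K k * z ^ k) (K z) := by
  obtain ⟨R, hR, hKR⟩ := exists_analyticOnNhd_annulus hρ hK
  have hR₀ : 0 < R := by linarith
  obtain ⟨M, -, hc⟩ := exists_norm_laurentCoeff_le (by linarith) hKR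
  refine ⟨M, R⁻¹, by positivity, inv_lt_one_of_one_lt₀ (by linarith), hc, fun z hz => ?_⟩
  exact hasSum_laurent (by linarith) hKR
    ((inv_strictAnti₀ (by linarith) hR).trans_le hz.1) (hz.2.trans_lt hR)

theorem correctionKernel_of_norm_lt_one {K : ℂ → ℂ} {n : ℕ} (hn : n ≠ 0) {z : ℂ} (hz₀ : z ≠ 0)
    (hz₁ : ‖z‖ < 1) (hK : HasSum (fun k : ℤ => laurentCoeff K k * z ^ k) (K z)) :
    correctionKernel K n z = z ^ (2 * n) / (z ^ (2 * n) - 1) * laurentMid K n z +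
      laurentPlus K n z := by
  have hlt : ‖z ^ (2 * n)‖ < 1 := by
    rw [norm_pow]
    exact pow_lt_one₀ (norm_nonneg z) hz₁ (by omega)
  have hne : z ^ (2 * n) - 1 ≠ 0 := fun h => by simp [sub_eq_zero.1 h] at hlt
  have hzn : z ^ n ≠ 0 := pow_ne_zero n hz₀
  rw [correctionKernel, powMinus, if_neg hz₁.not_ge, eq_laurentMid_add hn hK, zpow_neg,
    zpow_natCast]
  rw [mul_comm 2 n, pow_mul] at hne ⊢
  have hden : z ^ n - (z ^ n)⁻¹ = ((z ^ n) ^ 2 - 1) / z ^ n := by field_simp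
  rw [hden]
  field_simp
  ring

theorem correctionKernel_of_one_lt_norm {K : ℂ → ℂ} {n : ℕ} (hn : n ≠ 0) {z : ℂ} (hz : 1 < ‖z‖)
    (hK : HasSum (fun k : ℤ => laurentCoeff K k * z ^ k) (K z)) :
    correctionKernel K n z = laurentMid K n z / (z ^ (2 * n) - 1) - laurentMinus K n z := by
  have hlt : 1 < ‖z ^ (2 * n)‖ := by
    rw [norm_pow]
    exact one_lt_pow₀ hz (by omega)
  have hne : z ^ (2 * n) - 1 ≠ 0 := fun h => by simp [sub_eq_zero.1 h] at hlt
  have hzn : z ^ n ≠ 0 := pow_ne_zero n (norm_pos_iff.1 (zero_lt_one.trans hz))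
  rw [correctionKernel, powMinus, if_pos hz.le, eq_laurentMid_add hn hK, zpow_neg, zpow_natCast]
  rw [mul_comm 2 n, pow_mul] at hne ⊢
  have hden : z ^ n - (z ^ n)⁻¹ = ((z ^ n) ^ 2 - 1) / z ^ n := by field_simp
  rw [hden]
  field_simp
  ring

/-- The tail of the correction integrand after folding `[ρ⁻¹, 1]` onto `[1, ρ]`. -/
noncomputable def foldedTail (K : ℂ → ℂ) (n : ℕ) (y : ℝ) : ℂ :=
  (laurentPlus K n (y : ℂ)⁻¹ - laurentMinus K n y) / y

theorem correctionKernel_div_add_inv_sq_mul {K : ℂ → ℂ} {n : ℕ} (hn : n ≠ 0) {y : ℝ} (hy : 1 < y)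
    (hK : HasSum (fun k : ℤ => laurentCoeff K k * (y : ℂ) ^ k) (K y))
    (hK' : HasSum (fun k : ℤ => laurentCoeff K k * (y : ℂ)⁻¹ ^ k) (K (y : ℂ)⁻¹)) :
    correctionKernel K n y / y + ((y ^ 2)⁻¹ : ℝ) * (correctionKernel K n (y⁻¹ : ℝ) / (y⁻¹ : ℝ)) =
      ∑ k ∈ Finset.Icc (-n : ℤ) n, midCoeff K n k * aliasKernel (2 * n) k y + foldedTail K n y := by
  have hy₀ : (y : ℂ) ≠ 0 := by exact_mod_cast (zero_lt_one.trans hy).ne'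
  have hnorm : ‖(y : ℂ)‖ = y := by rw [Complex.norm_of_nonneg (by linarith)]
  have hne : (y : ℂ) ^ (2 * n) - 1 ≠ 0 := by
    exact_mod_cast (sub_pos.2 (one_lt_pow₀ hy (by omega : 2 * n ≠ 0))).ne'
  have hterm : ∀ k : ℤ, midCoeff K n k * (aliasKernel (2 * n) k y : ℂ) =
      (midCoeff K n k * (y : ℂ) ^ k - midCoeff K n k * (y : ℂ)⁻¹ ^ k) /
        ((y ^ (2 * n) - 1) * y) := by
    intro k
    rw [aliasKernel, inv_zpow']
    push_cast
    ring
  simp only [hterm]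
  rw [← Finset.sum_div, Finset.sum_sub_distrib, ← laurentMid_eq_sum K hn,
    ← laurentMid_eq_sum K hn, correctionKernel_of_one_lt_norm hn (by rwa [hnorm]) hK, ofReal_inv y,
    correctionKernel_of_norm_lt_one hn (inv_ne_zero hy₀)
      (by rw [norm_inv, hnorm]; exact inv_lt_one_of_one_lt₀ hy) hK', foldedTail]
  have hflip : (y : ℂ)⁻¹ ^ (2 * n) / ((y : ℂ)⁻¹ ^ (2 * n) - 1) =
      -(1 / ((y : ℂ) ^ (2 * n) - 1)) := by
    have hyn : (y : ℂ) ^ (2 * n) ≠ 0 := pow_ne_zero _ hy₀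
    rw [inv_pow, ← one_div, div_sub_one hyn, div_div_div_cancel_right₀ hyn, ← div_neg, neg_sub]
  rw [hflip]
  generalize (y : ℂ) ^ (2 * n) - 1 = D at hne ⊢
  push_cast
  field_simp
  ring

theorem ofReal_mem_annulus_of_mem_Icc {ρ y : ℝ} (hy : y ∈ Set.Icc 1 ρ) : (y : ℂ) ∈ annulus ρ :=
  have hρ : 1 ≤ ρ := hy.1.trans hy.2
  ofReal_mem_annulus (by linarith) ((inv_le_one_of_one_le₀ hρ).trans hy.1) hy.2

theorem isBigO_inv_pow_sub_one {m : ℕ} (hm : m ≠ 0) :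
    (fun y : ℝ => (y ^ m - 1)⁻¹) =O[𝓝[>] 1] fun y => (y - 1)⁻¹ := by
  refine IsBigO.of_norm_eventuallyLE ?_
  filter_upwards [self_mem_nhdsWithin] with y (hy : 1 < y)
  have hle : y ≤ y ^ m := le_self_pow₀ hy.le hm
  rw [Real.norm_of_nonneg (inv_nonneg.2 (by linarith))]
  exact inv_anti₀ (by linarith) (by linarith)

theorem intervalIntegrable_aliasKernel {m : ℕ} {k : ℤ} (hk : |k| < m) {ρ : ℝ} (hρ : 1 ≤ ρ) :
    IntervalIntegrable (fun y => (aliasKernel m k y : ℂ)) volume 1 ρ :=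
  (intervalIntegrable_iff_integrableOn_Ioc_of_le hρ).2
    ((integrableOn_aliasKernel hk le_rfl).mono_set Set.Ioc_subset_Ioi_self).ofReal

/-- The principal value of `∫ correctionKernel K n x / x` over `[ρ⁻¹, ρ]`, as an absolutely
convergent integral over `[1, ρ]` obtained from the substitution `x ↦ 1 / x` on `[ρ⁻¹, 1]`. -/
noncomputable def correctionIntegral (K : ℂ → ℂ) (n : ℕ) (ρ : ℝ) : ℂ :=
  (∑ k ∈ Finset.Icc (-n : ℤ) n,
    midCoeff K n k * (∫ y in (1 : ℝ)..ρ, aliasKernel (2 * n) k y : ℝ)) +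
    ∫ y in (1 : ℝ)..ρ, foldedTail K n y

theorem continuousOn_laurentMinus_ofReal {K : ℂ → ℂ} {M q : ℝ}
    (hc : ∀ k, ‖laurentCoeff K k‖ ≤ M * q ^ k.natAbs) (hq₀ : 0 ≤ q) (hq₁ : q < 1) (n : ℕ) :
    ContinuousOn (fun y : ℝ => laurentMinus K n y) (Set.Ici 1) :=
  (continuousOn_laurentMinus hc hq₀ hq₁ n).comp continuous_ofReal.continuousOn
    fun y (hy : 1 ≤ y) => by
      change 1 ≤ ‖(y : ℂ)‖
      rwa [Complex.norm_of_nonneg (by linarith)]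

theorem continuousOn_foldedTail {K : ℂ → ℂ} {M q : ℝ}
    (hc : ∀ k, ‖laurentCoeff K k‖ ≤ M * q ^ k.natAbs) (hq₀ : 0 ≤ q) (hq₁ : q < 1) (n : ℕ) :
    ContinuousOn (foldedTail K n) (Set.Ici 1) := by
  have hne : ∀ y ∈ Set.Ici (1 : ℝ), (y : ℂ) ≠ 0 := fun y hy =>
    ofReal_ne_zero.2 (zero_lt_one.trans_le hy).ne'
  have hplus : ContinuousOn (fun y : ℝ => laurentPlus K n (y : ℂ)⁻¹) (Set.Ici 1) :=
    (continuousOn_laurentPlus hc hq₀ hq₁ n).comp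
      (continuous_ofReal.continuousOn.inv₀ hne) fun y (hy : 1 ≤ y) => by
        rw [mem_closedBall_zero_iff, norm_inv, Complex.norm_of_nonneg (by linarith)]
        exact inv_le_one_of_one_le₀ hy
  exact (hplus.sub (continuousOn_laurentMinus_ofReal hc hq₀ hq₁ n)).div
    continuous_ofReal.continuousOn hne

theorem norm_foldedTail_le {K : ℂ → ℂ} {M q : ℝ}
    (hc : ∀ k, ‖laurentCoeff K k‖ ≤ M * q ^ k.natAbs) (hq₀ : 0 ≤ q) (hq₁ : q < 1)
    (n : ℕ) {y : ℝ} (hy : 1 ≤ y) :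
    ‖foldedTail K n y‖ ≤ 2 * (M / (1 - q)) * q ^ n := by
  have hnorm : ‖(y : ℂ)‖ = y := by rw [Complex.norm_of_nonneg (by linarith)]
  have hplus : ‖laurentPlus K n (y : ℂ)⁻¹‖ ≤ M / (1 - q) * q ^ n :=
    norm_laurentPlus_le hc hq₀ hq₁ n (by
      rw [norm_inv, hnorm]
      exact inv_le_one_of_one_le₀ hy)
  have hminus := norm_laurentMinus_le hc hq₀ hq₁ n (hnorm.symm ▸ hy)
  rw [foldedTail, norm_div, hnorm]
  calc ‖laurentPlus K n (y : ℂ)⁻¹ - laurentMinus K n y‖ / y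
      ≤ ‖laurentPlus K n (y : ℂ)⁻¹ - laurentMinus K n y‖ := div_le_self (norm_nonneg _) hy
    _ ≤ M / (1 - q) * q ^ n + M / (1 - q) * q ^ n := norm_sub_le_of_le hplus hminus
    _ = 2 * (M / (1 - q)) * q ^ n := by ring

theorem continuousOn_correctionKernel_Ico {K : ℂ → ℂ} {M q ρ : ℝ}
    (hc : ∀ k, ‖laurentCoeff K k‖ ≤ M * q ^ k.natAbs) (hq₀ : 0 ≤ q) (hq₁ : q < 1)
    {n : ℕ} (hn : n ≠ 0) (hρ : 1 < ρ)
    (hK : ∀ z ∈ annulus ρ, HasSum (fun k : ℤ => laurentCoeff K k * z ^ k) (K z)) :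
    ContinuousOn (fun x : ℝ => correctionKernel K n x / x) (Set.Ico ρ⁻¹ 1) := by
  have hpos : ∀ x ∈ Set.Ico ρ⁻¹ 1, 0 < x := fun x hx => (inv_pos.2 (by linarith)).trans_le hx.1
  have hne : ∀ x ∈ Set.Ico ρ⁻¹ 1, (x : ℂ) ≠ 0 := fun x hx => ofReal_ne_zero.2 (hpos x hx).ne'
  have hnorm : ∀ x ∈ Set.Ico ρ⁻¹ 1, ‖(x : ℂ)‖ < 1 := fun x hx => by
    rw [Complex.norm_of_nonneg (hpos x hx).le]
    exact hx.2
  refine ContinuousOn.div (ContinuousOn.congr (f := fun x : ℝ => (x : ℂ) ^ (2 * n) /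
      ((x : ℂ) ^ (2 * n) - 1) * laurentMid K n x + laurentPlus K n x) ?_ fun x hx =>
    correctionKernel_of_norm_lt_one hn (hne x hx) (hnorm x hx)
      (hK x (ofReal_mem_annulus (by linarith) hx.1 (by linarith [hx.2]))))
    continuous_ofReal.continuousOn hne
  refine ((ContinuousOn.div (by fun_prop) (by fun_prop) fun x hx => ?_).mul
    ((continuousOn_laurentMid K n).comp continuous_ofReal.continuousOn hne)).add
    ((continuousOn_laurentPlus hc hq₀ hq₁ n).comp continuous_ofReal.continuousOn fun x hx =>
      mem_closedBall_zero_iff.2 (hnorm x hx).le)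
  exact_mod_cast (sub_neg.2 (pow_lt_one₀ (hpos x hx).le hx.2 (by omega : 2 * n ≠ 0))).ne

theorem continuousOn_correctionKernel_Ioc {K : ℂ → ℂ} {M q ρ : ℝ}
    (hc : ∀ k, ‖laurentCoeff K k‖ ≤ M * q ^ k.natAbs) (hq₀ : 0 ≤ q) (hq₁ : q < 1)
    {n : ℕ} (hn : n ≠ 0)
    (hK : ∀ z ∈ annulus ρ, HasSum (fun k : ℤ => laurentCoeff K k * z ^ k) (K z)) :
    ContinuousOn (fun x : ℝ => correctionKernel K n x / x) (Set.Ioc 1 ρ) := by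
  have hne : ∀ x ∈ Set.Ioc 1 ρ, (x : ℂ) ≠ 0 := fun x hx =>
    ofReal_ne_zero.2 (zero_lt_one.trans hx.1).ne'
  have hnorm : ∀ x ∈ Set.Ioc 1 ρ, 1 < ‖(x : ℂ)‖ := fun x hx => by
    rw [Complex.norm_of_nonneg (by linarith [hx.1])]
    exact hx.1
  refine ContinuousOn.div (ContinuousOn.congr (f := fun x : ℝ => laurentMid K n x /
      ((x : ℂ) ^ (2 * n) - 1) - laurentMinus K n x) ?_ fun x hx =>
    correctionKernel_of_one_lt_norm hn (hnorm x hx)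
      (hK x (ofReal_mem_annulus_of_mem_Icc ⟨hx.1.le, hx.2⟩))) continuous_ofReal.continuousOn hne
  refine (((continuousOn_laurentMid K n).comp continuous_ofReal.continuousOn hne).div
    (by fun_prop) fun x hx => ?_).sub ((continuousOn_laurentMinus_ofReal hc hq₀ hq₁ n).mono
      fun x hx => hx.1.le)
  exact_mod_cast (sub_pos.2 (one_lt_pow₀ hx.1 (by omega : 2 * n ≠ 0))).ne'

theorem isBigO_correctionKernel {K : ℂ → ℂ} {M q ρ : ℝ}
    (hc : ∀ k, ‖laurentCoeff K k‖ ≤ M * q ^ k.natAbs) (hq₀ : 0 ≤ q) (hq₁ : q < 1)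
    {n : ℕ} (hn : n ≠ 0) (hρ : 1 < ρ)
    (hK : ∀ z ∈ annulus ρ, HasSum (fun k : ℤ => laurentCoeff K k * z ^ k) (K z)) :
    (fun x : ℝ => correctionKernel K n x / x) =O[𝓝[>] 1] fun x => (x - 1)⁻¹ := by
  have hmid : (fun x : ℝ => laurentMid K n x / x) =O[𝓝[>] 1] fun _ => (1 : ℝ) := by
    have hcont : ContinuousAt (fun z : ℂ => laurentMid K n z / z) (1 : ℝ) :=
      ((continuousOn_laurentMid K n).continuousAt
        (isOpen_compl_singleton.mem_nhds (by simp))).div continuousAt_id (by simp)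
    exact (hcont.comp continuous_ofReal.continuousAt).continuousWithinAt.tendsto.isBigO_one ℝ
  have hminus : (fun x : ℝ => laurentMinus K n x / x) =O[𝓝[>] 1] fun _ => (1 : ℝ) := by
    have hcont : ContinuousOn (fun x : ℝ => laurentMinus K n x / x) (Set.Ici 1) :=
      (continuousOn_laurentMinus_ofReal hc hq₀ hq₁ n).div continuous_ofReal.continuousOn
        fun x hx => ofReal_ne_zero.2 (zero_lt_one.trans_le hx).ne'
    exact ((hcont 1 Set.self_mem_Ici).mono Set.Ioi_subset_Ici_self).tendsto.isBigO_one ℝ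
  have hone : (fun _ => (1 : ℝ)) =O[𝓝[>] 1] fun x : ℝ => (x - 1)⁻¹ := by
    refine IsBigO.of_norm_eventuallyLE ?_
    filter_upwards [Ioo_mem_nhdsGT (show (1 : ℝ) < 2 by norm_num)] with x hx
    rw [norm_one]
    exact (one_le_inv₀ (by linarith [hx.1])).2 (by linarith [hx.2])
  have hpole : (fun x : ℝ => ((x : ℂ) ^ (2 * n) - 1)⁻¹) =O[𝓝[>] 1] fun x => (x - 1)⁻¹ := by
    refine IsBigO.of_norm_left ((isBigO_inv_pow_sub_one (m := 2 * n)
      (by omega)).norm_left.congr_left fun x => ?_)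
    rw [← Complex.norm_real]
    push_cast
    rfl
  have hsum := (hpole.mul hmid).sub ((hminus.trans hone).congr_right fun x => (mul_one _).symm)
  simp only [mul_one] at hsum
  refine hsum.congr' ?_ EventuallyEq.rfl
  filter_upwards [Ioc_mem_nhdsGT hρ] with x hx
  rw [correctionKernel_of_one_lt_norm hn (by
    rw [Complex.norm_of_nonneg (by linarith [hx.1])]
    exact hx.1) (hK x (ofReal_mem_annulus_of_mem_Icc ⟨hx.1.le, hx.2⟩))]
  ring

theorem isPrincipalValue_correctionKernel {K : ℂ → ℂ} {M q ρ : ℝ}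
    (hc : ∀ k, ‖laurentCoeff K k‖ ≤ M * q ^ k.natAbs) (hq₀ : 0 ≤ q) (hq₁ : q < 1)
    {n : ℕ} (hn : n ≠ 0) (hρ : 1 < ρ)
    (hK : ∀ z ∈ annulus ρ, HasSum (fun k : ℤ => laurentCoeff K k * z ^ k) (K z)) :
    IsPrincipalValue (fun x : ℝ => correctionKernel K n x / x) ρ⁻¹ 1 ρ
      (correctionIntegral K n ρ) := by
  have hfold : ∀ y ∈ Set.Ioc 1 ρ,
      correctionKernel K n y / y + ((y ^ 2)⁻¹ : ℝ) * (correctionKernel K n (y⁻¹ : ℝ) / (y⁻¹ : ℝ)) =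
        ∑ k ∈ Finset.Icc (-n : ℤ) n, midCoeff K n k * aliasKernel (2 * n) k y +
          foldedTail K n y := by
    intro y hy
    have hyρ : y⁻¹ ∈ Set.Icc ρ⁻¹ ρ :=
      ⟨inv_anti₀ (by linarith [hy.1]) hy.2, (inv_le_one_of_one_le₀ hy.1.le).trans hρ.le⟩
    refine correctionKernel_div_add_inv_sq_mul hn hy.1
      (hK y (ofReal_mem_annulus_of_mem_Icc ⟨hy.1.le, hy.2⟩)) ?_
    rw [← ofReal_inv]
    exact hK _ (ofReal_mem_annulus (by linarith) hyρ.1 hyρ.2)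
  have halias := fun k (hk : k ∈ Finset.Icc (-n : ℤ) n) =>
    (intervalIntegrable_aliasKernel (show |k| < (2 * n : ℕ) by
      have := abs_le.2 (Finset.mem_Icc.1 hk)
      omega) hρ.le).const_mul (midCoeff K n k)
  have htail : IntervalIntegrable (foldedTail K n) volume 1 ρ :=
    ((continuousOn_foldedTail hc hq₀ hq₁ n).mono
      (Set.uIcc_of_le hρ.le ▸ Set.Icc_subset_Ici_self)).intervalIntegrable
  have hsum := IntervalIntegrable.sum _ halias
  rw [Finset.sum_fn] at hsum
  have hPV := isPrincipalValue_of_continuousOn hρ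
    (continuousOn_correctionKernel_Ico hc hq₀ hq₁ hn hρ hK)
    (continuousOn_correctionKernel_Ioc hc hq₀ hq₁ hn hK)
    (isBigO_correctionKernel hc hq₀ hq₁ hn hρ hK)
    ((hsum.add htail).congr fun y hy => (hfold y (Set.uIoc_of_le hρ.le ▸ hy)).symm)
  rw [intervalIntegral.integral_congr_Ioo_of_le hρ.le fun y hy => hfold y ⟨hy.1, hy.2.le⟩,
    intervalIntegral.integral_add hsum htail,
    intervalIntegral.integral_finsetSum halias] at hPV
  simpa only [correctionIntegral, intervalIntegral.integral_const_mul,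
    intervalIntegral.integral_ofReal] using hPV

/-! ### Analytic functions on the cut annulus -/

theorem exp_I_mul_mem_cutAnnulus {r : ℝ} (hr : 0 < r) {t : ℂ}
    (ht : t ∈ Set.Ioo 0 (2 * Real.pi) ×ℂ Set.Ioo (-Real.log r) (Real.log r)) :
    exp (I * t) ∈ cutAnnulus r := by
  obtain ⟨⟨hre₀, hre₁⟩, him₀, him₁⟩ := mem_reProdIm.1 ht
  have hnorm : ‖exp (I * t)‖ = Real.exp (-t.im) := by simp [norm_exp]
  refine ⟨⟨?_, ?_⟩, ?_⟩
  · rw [hnorm, ← Real.exp_log hr, ← Real.exp_neg]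
    exact Real.exp_le_exp.2 (by linarith)
  · rw [hnorm, ← Real.exp_log hr]
    exact Real.exp_le_exp.2 (by linarith)
  · rintro ⟨x, hx, hxt⟩
    have hx₀ : 0 < x := (inv_pos.2 hr).trans_le hx.1
    rw [← Real.exp_log hx₀, ofReal_exp] at hxt
    obtain ⟨n, hn⟩ := exp_eq_exp_iff_exists_int.1 hxt.symm
    have hre : t.re = n * (2 * Real.pi) := by simpa using congrArg im hn
    have hn₀ : (0 : ℝ) < n := pos_of_mul_pos_left (hre ▸ hre₀) Real.two_pi_pos.le
    have hn₁ : (n : ℝ) < 1 := by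
      rwa [hre, mul_lt_iff_lt_one_left Real.two_pi_pos] at hre₁
    norm_cast at hn₀ hn₁
    omega

theorem differentiableOn_comp_exp_I_mul {u : ℂ → ℂ} {r : ℝ} (hr : 0 < r)
    (hu : AnalyticOnNhd ℂ u (cutAnnulus r)) :
    DifferentiableOn ℂ (fun t => u (exp (I * t)))
      (Set.Ioo 0 (2 * Real.pi) ×ℂ Set.Ioo (-Real.log r) (Real.log r)) :=
  hu.differentiableOn.comp (by fun_prop) fun _ ht => exp_I_mul_mem_cutAnnulus hr ht

theorem continuousOn_ofReal_of_differentiableOn_reProdIm {f : ℂ → ℂ} {s : Set ℝ} {L : ℝ}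
    (hL : 0 < L) (hf : DifferentiableOn ℂ f (s ×ℂ Set.Ioo (-L) L)) :
    ContinuousOn (fun t : ℝ => f t) s :=
  hf.continuousOn.comp continuous_ofReal.continuousOn fun t ht =>
    mem_reProdIm.2 ⟨ht, by simpa using hL⟩

theorem tendsto_ofReal_of_isBigO_sector {f : ℂ → ℂ} {κ β : ℝ} {a : ℂ} (hκ : 0 < κ) (hβ : 0 < β)
    (hf : (fun t => f t - a) =O[𝓝[sector κ] 0] fun t => ‖t‖ ^ β) :
    Tendsto (fun t : ℝ => f t) (𝓝[>] 0) (𝓝 a) := by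
  have hpow : Tendsto (fun t : ℂ => ‖t‖ ^ β) (𝓝[sector κ] 0) (𝓝 0) := by
    have hcont : Continuous fun t : ℂ => ‖t‖ ^ β := continuous_norm.rpow_const fun _ => Or.inr hβ.le
    simpa [Real.zero_rpow hβ.ne'] using (hcont.tendsto 0).mono_left nhdsWithin_le_nhds
  exact (tendsto_sub_nhds_zero_iff.1 (hf.trans_tendsto hpow)).comp
    (tendsto_ofReal_nhdsWithin_sector hκ)

theorem exists_continuousOn_Icc_eqOn_Ioo {f : ℂ → ℂ} {κ β c : ℝ} {a b : ℂ} (hκ : 0 < κ)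
    (hβ : 0 < β) (hc : 0 < c) (hf : ContinuousOn (fun t : ℝ => f t) (Set.Ioo 0 c))
    (ha : (fun t => f t - a) =O[𝓝[sector κ] 0] fun t => ‖t‖ ^ β)
    (hb : (fun t => f (c - t) - b) =O[𝓝[sector κ] 0] fun t => ‖t‖ ^ β) :
    ∃ w : ℝ → ℂ, ContinuousOn w (Set.Icc 0 c) ∧ w 0 = a ∧ w c = b ∧
      Set.EqOn w (fun t => f t) (Set.Ioo 0 c) := by
  have hleft := tendsto_ofReal_of_isBigO_sector hκ hβ ha
  have hreflect : Tendsto (fun t : ℝ => c - t) (𝓝[<] c) (𝓝[>] 0) := by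
    refine tendsto_nhdsWithin_iff.2 ⟨?_, ?_⟩
    · have hcont : Continuous fun t : ℝ => c - t := by fun_prop
      exact (hcont.tendsto' c 0 (sub_self c)).mono_left nhdsWithin_le_nhds
    · filter_upwards [self_mem_nhdsWithin] with t (ht : t < c) using sub_pos.2 ht
  have hright : Tendsto (fun t : ℝ => f t) (𝓝[<] c) (𝓝 b) := by
    simpa [Function.comp_def] using (tendsto_ofReal_of_isBigO_sector hκ hβ hb).comp hreflect
  exact ⟨extendFrom (Set.Ioo 0 c) fun t : ℝ => f t,
    continuousOn_Icc_extendFrom_Ioo hf hleft hright,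
    eq_lim_at_left_extendFrom_Ioo hc hleft, eq_lim_at_right_extendFrom_Ioo hc hright,
    fun t ht => extendFrom_extends hf t ht⟩

theorem isBigO_fourierCoeffOn_sub_of_eqOn {f : ℂ → ℂ} {w : ℝ → ℂ} {κ α L : ℝ} (hκ : 0 < κ)
    (hα : 1 ≤ α) (hL : 0 < L)
    (hf : DifferentiableOn ℂ f (Set.Ioo 0 (2 * Real.pi) ×ℂ Set.Ioo (-L) L))
    (ha : (fun t => f t - w 0) =O[𝓝[sector κ] 0] fun t => ‖t‖ ^ (α - 1))
    (hb : (fun t => f (2 * Real.pi - t) - w (2 * Real.pi)) =O[𝓝[sector κ] 0]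
      fun t => ‖t‖ ^ (α - 1))
    (hw : ContinuousOn w (Set.Icc 0 (2 * Real.pi)))
    (hwf : Set.EqOn w (fun t => f t) (Set.Ioo 0 (2 * Real.pi))) :
    (fun m : ℤ => fourierCoeffOn Real.two_pi_pos w m -
      (w (2 * Real.pi) - w 0) / (2 * Real.pi) * (I / m)) =O[cofinite]
        fun m => |(m : ℝ)| ^ (-α) := by
  have hfi : IntervalIntegrable (fun t : ℝ => f t) volume 0 (2 * Real.pi) :=
    (hw.intervalIntegrable_of_Icc Real.two_pi_pos.le).congr_uIoo
      (by rwa [Set.uIoo_of_le Real.two_pi_pos.le])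
  refine (isBigO_fourierCoeffOn_sub hκ hα hL hf ha hb hfi).congr_left fun m => ?_
  have hcongr : Set.EqOn (fun t : ℝ => exp (-(m * t * I)) * f t)
      (fun t => exp (-(m * t * I)) * w t) (Set.Ioo 0 (2 * Real.pi)) := fun t ht =>
    congrArg (exp (-(m * t * I)) * ·) (hwf ht).symm
  rw [fourierCoeffOn_two_pi, fourierCoeffOn_two_pi,
    intervalIntegral.integral_congr_Ioo_of_le Real.two_pi_pos.le hcongr]

/-! ### The error estimate -/

theorem isBigO_pow_rpow (s : ℝ) {q : ℝ} (hq₀ : 0 < q) (hq₁ : q < 1) :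
    (fun n : ℕ => q ^ n) =O[atTop] fun n => (n : ℝ) ^ s := by
  have hexp := (isLittleO_exp_neg_mul_rpow_atTop (neg_pos.2 (Real.log_neg hq₀ hq₁)) s).isBigO
  refine (hexp.comp_tendsto tendsto_natCast_atTop_atTop).congr_left fun n => ?_
  rw [Function.comp_apply, neg_neg, ← Real.rpow_def_of_pos hq₀, Real.rpow_natCast]

theorem trapezoid_eq_trapezoidalSum {g : ℂ → ℂ} {v : ℝ → ℂ} (m : ℕ)
    (hv : Set.EqOn v (fun t => g (exp (I * t))) (Set.Ioo 0 (2 * Real.pi))) :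
    trapezoid m g (v 0) (v (2 * Real.pi)) = trapezoidalSum m v := by
  rw [trapezoid, trapezoidalSum, Finset.sum_congr rfl fun j hj => ?_]
  obtain ⟨hj₀, hj₁⟩ := Finset.mem_Ico.1 hj
  have hpos : 0 < 2 * Real.pi * j / m := by
    have : 0 < m := by omega
    have : 0 < j := by omega
    positivity
  rw [hv ⟨hpos, (grid_mem_Ico hj₁).2⟩]
  push_cast
  ring_nf

theorem norm_sum_midCoeff_mul_le {K : ℂ → ℂ} {M q C : ℝ} (hq₀ : 0 ≤ q) (hq₁ : q < 1)
    (hc : ∀ k, ‖laurentCoeff K k‖ ≤ M * q ^ k.natAbs) (n : ℕ) {s : Finset ℤ} {e : ℤ → ℂ}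
    (he : ∀ k ∈ s, ‖e k‖ ≤ C) (hC : 0 ≤ C) :
    ‖∑ k ∈ s, midCoeff K n k * e k‖ ≤ (∑' k : ℤ, M * q ^ k.natAbs) * C := by
  have hsum : Summable fun k : ℤ => M * q ^ k.natAbs := (summable_pow_natAbs hq₀ hq₁).mul_left M
  calc ‖∑ k ∈ s, midCoeff K n k * e k‖ ≤ ∑ k ∈ s, M * q ^ k.natAbs * C :=
        norm_sum_le_of_le s fun k hk => by
          rw [norm_mul]
          exact mul_le_mul ((norm_midCoeff_le K n k).trans (hc k)) (he k hk) (norm_nonneg _)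
            ((norm_nonneg _).trans (hc k))
    _ = (∑ k ∈ s, M * q ^ k.natAbs) * C := (Finset.sum_mul _ _ _).symm
    _ ≤ (∑' k : ℤ, M * q ^ k.natAbs) * C := by
        gcongr
        exact hsum.sum_le_tsum s fun k _ => (norm_nonneg _).trans (hc k)

theorem trapezoidalError_laurentMid_mul (K : ℂ → ℂ) {w : ℝ → ℂ}
    (hw : ContinuousOn w (Set.Icc 0 (2 * Real.pi))) (m : ℕ) {n : ℕ} (hn : n ≠ 0) :
    trapezoidalError m (fun t => laurentMid K n (exp (I * t)) * w t) =
      ∑ k ∈ Finset.Icc (-n : ℤ) n,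
        midCoeff K n k * trapezoidalError m (fun t => exp (k * t * I) * w t) := by
  have hterm : ∀ (k : ℤ) (t : ℝ),
      exp (I * t) ^ k * w t = exp (k * t * I) * w t := fun k t => by
    rw [← exp_int_mul, mul_comm I, mul_assoc]
  simp only [laurentMid_eq_sum K hn, Finset.sum_mul, mul_assoc (midCoeff K n _), hterm]
  rw [trapezoidalError_sum]
  · simp only [trapezoidalError_const_mul]
  · intro k _
    refine ContinuousOn.intervalIntegrable ?_
    rw [Set.uIcc_of_le Real.two_pi_pos.le]
    fun_prop

theorem isBigO_trapezoidalError_laurentMid_mul_sub {K : ℂ → ℂ} {w : ℝ → ℂ} {M q α : ℝ}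
    (hq₀ : 0 ≤ q) (hq₁ : q < 1) (hc : ∀ k, ‖laurentCoeff K k‖ ≤ M * q ^ k.natAbs)
    (hw : ContinuousOn w (Set.Icc 0 (2 * Real.pi))) (hα : 1 < α)
    (hdecay : (fun s : ℤ => fourierCoeffOn Real.two_pi_pos w s -
        (w (2 * Real.pi) - w 0) / (2 * Real.pi) * (I / s))
      =O[cofinite] fun s => |(s : ℝ)| ^ (-α)) :
    (fun n : ℕ => trapezoidalError (2 * n) (fun t => laurentMid K n (exp (I * t)) * w t) -
      (w (2 * Real.pi) - w 0) * I * ∑ k ∈ Finset.Icc (-n : ℤ) n,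
        midCoeff K n k * (∫ y in Set.Ioi (1 : ℝ), aliasKernel (2 * n) k y : ℝ))
      =O[atTop] fun n => (n : ℝ) ^ (-α) := by
  obtain ⟨C, hC⟩ := exists_norm_trapezoidalError_exp_mul_sub_le hw hα hdecay
  have hdouble : Tendsto (fun n : ℕ => 2 * n) atTop atTop :=
    tendsto_id.const_mul_atTop' two_pos
  have hscale : (fun n : ℕ => ((2 * n : ℕ) : ℝ) ^ (-α)) =O[atTop] fun n => (n : ℝ) ^ (-α) := by
    refine IsBigO.of_bound (2 ^ (-α)) (Eventually.of_forall fun n => le_of_eq ?_)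
    push_cast
    rw [Real.mul_rpow zero_le_two n.cast_nonneg, norm_mul, Real.norm_of_nonneg (by positivity)]
  refine IsBigO.trans (IsBigO.of_bound ((∑' k : ℤ, M * q ^ k.natAbs) * C) ?_) hscale
  filter_upwards [hdouble.eventually hC, eventually_ne_atTop 0] with n hn hn₀
  have hmem : ∀ k ∈ Finset.Icc (-n : ℤ) n, 2 * |k| ≤ (2 * n : ℕ) := fun k hk => by
    have := abs_le.2 (Finset.mem_Icc.1 hk)
    omega
  have hC₀ : 0 ≤ C * ((2 * n : ℕ) : ℝ) ^ (-α) := (norm_nonneg _).trans (hn 0 (by simp))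
  rw [trapezoidalError_laurentMid_mul K hw _ hn₀, Finset.mul_sum, ← Finset.sum_sub_distrib,
    Real.norm_of_nonneg (by positivity), mul_assoc _ C]
  refine le_trans (le_of_eq ?_)
    (norm_sum_midCoeff_mul_le hq₀ hq₁ hc n (fun k hk => hn k (hmem k hk)) hC₀)
  congr! 2 with k
  ring

theorem isBigO_sum_midCoeff_mul_integral_sub {K : ℂ → ℂ} {M q ρ : ℝ}
    (hq₀ : 0 ≤ q) (hq₁ : q < 1) (hc : ∀ k, ‖laurentCoeff K k‖ ≤ M * q ^ k.natAbs) (hρ : 1 ≤ ρ) :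
    (fun n : ℕ => ∑ k ∈ Finset.Icc (-n : ℤ) n,
        midCoeff K n k * (∫ y in Set.Ioi (1 : ℝ), aliasKernel (2 * n) k y : ℝ) -
      ∑ k ∈ Finset.Icc (-n : ℤ) n,
        midCoeff K n k * (∫ y in (1 : ℝ)..ρ, aliasKernel (2 * n) k y : ℝ))
      =O[atTop] fun n => ρ⁻¹ ^ n := by
  refine IsBigO.of_bound ((∑' k : ℤ, M * q ^ k.natAbs) * 2) ?_
  filter_upwards [eventually_ne_atTop 0] with n hn
  have : 0 < ρ := zero_lt_one.trans_le hρ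
  have hterm : ∀ k ∈ Finset.Icc (-n : ℤ) n, ‖((∫ y in Set.Ioi (1 : ℝ), aliasKernel (2 * n) k y : ℝ)
      - (∫ y in (1 : ℝ)..ρ, aliasKernel (2 * n) k y : ℝ) : ℂ)‖ ≤ 2 * ρ⁻¹ ^ n := by
    intro k hk
    have hkn := abs_le.2 (Finset.mem_Icc.1 hk)
    have hk' : |k| < (2 * n : ℕ) := by omega
    rw [← ofReal_sub, norm_real, Real.norm_eq_abs, ← intervalIntegral.integral_Ioi_sub_Ioi
      (integrableOn_aliasKernel hk' le_rfl) hρ, sub_sub_cancel]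
    refine (abs_integral_Ioi_aliasKernel_le hk' hρ).trans ?_
    rw [inv_pow, ← zpow_natCast, ← zpow_neg]
    gcongr
    omega
  rw [← Finset.sum_sub_distrib, Real.norm_of_nonneg (by positivity), mul_assoc]
  simp only [← mul_sub]
  exact norm_sum_midCoeff_mul_le hq₀ hq₁ hc n hterm (by positivity)

theorem isBigO_integral_laurentPlus_add_laurentMinus_mul {K : ℂ → ℂ} {w : ℝ → ℂ} {M q : ℝ}
    (hq₀ : 0 ≤ q) (hq₁ : q < 1) (hc : ∀ k, ‖laurentCoeff K k‖ ≤ M * q ^ k.natAbs)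
    (hw : ContinuousOn w (Set.Icc 0 (2 * Real.pi))) :
    (fun n : ℕ => ∫ t in (0 : ℝ)..(2 * Real.pi),
      (laurentPlus K n (exp (I * t)) + laurentMinus K n (exp (I * t))) * w t)
      =O[atTop] fun n => q ^ n := by
  obtain ⟨W, hW⟩ := isCompact_Icc.exists_bound_of_continuousOn hw
  refine IsBigO.of_bound (2 * (M / (1 - q)) * W * |2 * Real.pi - 0|)
    (Eventually.of_forall fun n => ?_)
  have hbound : ∀ t ∈ Set.uIoc 0 (2 * Real.pi),
      ‖(laurentPlus K n (exp (I * t)) + laurentMinus K n (exp (I * t))) * w t‖ ≤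
        (M / (1 - q) * q ^ n + M / (1 - q) * q ^ n) * W := by
    intro t ht
    have hnorm : ‖exp (I * t)‖ = 1 := norm_exp_I_mul_ofReal t
    have hsum := norm_add_le_of_le (norm_laurentPlus_le hc hq₀ hq₁ n hnorm.le)
      (norm_laurentMinus_le hc hq₀ hq₁ n hnorm.ge)
    rw [norm_mul]
    exact mul_le_mul hsum (hW t (Set.Ioc_subset_Icc_self (Set.uIoc_of_le Real.two_pi_pos.le ▸ ht)))
      (norm_nonneg _) ((norm_nonneg _).trans hsum)
  rw [Real.norm_of_nonneg (by positivity)]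
  refine (intervalIntegral.norm_integral_le_of_norm_le_const hbound).trans_eq ?_
  ring

theorem isBigO_integral_foldedTail {K : ℂ → ℂ} {M q ρ : ℝ}
    (hq₀ : 0 ≤ q) (hq₁ : q < 1) (hc : ∀ k, ‖laurentCoeff K k‖ ≤ M * q ^ k.natAbs) (hρ : 1 ≤ ρ) :
    (fun n : ℕ => ∫ y in (1 : ℝ)..ρ, foldedTail K n y) =O[atTop] fun n => q ^ n := by
  refine IsBigO.of_bound (2 * (M / (1 - q)) * |ρ - 1|) (Eventually.of_forall fun n => ?_)
  have hbound : ∀ y ∈ Set.uIoc 1 ρ, ‖foldedTail K n y‖ ≤ 2 * (M / (1 - q)) * q ^ n := fun y hy =>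
    norm_foldedTail_le hc hq₀ hq₁ n (Set.uIoc_of_le hρ ▸ hy).1.le
  rw [Real.norm_of_nonneg (by positivity), mul_right_comm]
  exact intervalIntegral.norm_integral_le_of_norm_le_const hbound

theorem intervalIntegrable_comp_exp_I_mul_mul {K : ℂ → ℂ} {w : ℝ → ℂ}
    (hK : ContinuousOn K (Metric.sphere 0 1)) (hw : ContinuousOn w (Set.Icc 0 (2 * Real.pi))) :
    IntervalIntegrable (fun t : ℝ => K (exp (I * t)) * w t) volume 0 (2 * Real.pi) := by
  have hsphere : ∀ t : ℝ, exp (I * t) ∈ Metric.sphere 0 1 := fun t =>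
    mem_sphere_zero_iff_norm.2 (norm_exp_I_mul_ofReal t)
  exact ((hK.comp_continuous (by fun_prop) hsphere).continuousOn.mul hw).intervalIntegrable_of_Icc
    Real.two_pi_pos.le

theorem trapezoid_sub_circleInt {u K : ℂ → ℂ} {w : ℝ → ℂ} (m : ℕ) {n : ℕ} (hn : n ≠ 0)
    (hKc : ContinuousOn K (Metric.sphere 0 1))
    (hK : ∀ z ∈ Metric.sphere 0 1, HasSum (fun k : ℤ => laurentCoeff K k * z ^ k) (K z))
    (hw : ContinuousOn w (Set.Icc 0 (2 * Real.pi)))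
    (hwu : Set.EqOn w (fun t => u (exp (I * t))) (Set.Ioo 0 (2 * Real.pi))) :
    trapezoid m (fun z => laurentMid K n z * u z) (laurentMid K n 1 * w 0)
        (laurentMid K n 1 * w (2 * Real.pi)) - circleInt (fun z => K z * u z) =
      trapezoidalError m (fun t => laurentMid K n (exp (I * t)) * w t) -
        ∫ t in (0 : ℝ)..(2 * Real.pi),
          (laurentPlus K n (exp (I * t)) + laurentMinus K n (exp (I * t))) * w t := by
  have hsphere : ∀ t : ℝ, exp (I * t) ∈ Metric.sphere 0 1 := fun t =>
    mem_sphere_zero_iff_norm.2 (norm_exp_I_mul_ofReal t)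
  have hsum : trapezoid m (fun z => laurentMid K n z * u z) (laurentMid K n 1 * w 0)
      (laurentMid K n 1 * w (2 * Real.pi)) =
        trapezoidalSum m (fun t => laurentMid K n (exp (I * t)) * w t) := by
    have h2pi : exp (I * ((2 * Real.pi : ℝ) : ℂ)) = 1 := by
      simp [mul_comm I]
    have hv : Set.EqOn (fun t : ℝ => laurentMid K n (exp (I * t)) * w t)
        (fun t => laurentMid K n (exp (I * t)) * u (exp (I * t))) (Set.Ioo 0 (2 * Real.pi)) :=
      fun t ht => congrArg (laurentMid K n (exp (I * t)) * ·) (hwu ht)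
    rw [← trapezoid_eq_trapezoidalSum (g := fun z => laurentMid K n z * u z) m hv, h2pi,
      ofReal_zero, mul_zero, exp_zero]
  have hint : circleInt (fun z => K z * u z) =
      ∫ t in (0 : ℝ)..(2 * Real.pi), K (exp (I * t)) * w t :=
    intervalIntegral.integral_congr_Ioo_of_le Real.two_pi_pos.le fun t ht =>
      congrArg (K (exp (I * t)) * ·) (hwu ht).symm
  have htail : ∀ t : ℝ, laurentPlus K n (exp (I * t)) + laurentMinus K n (exp (I * t)) =
      K (exp (I * t)) - laurentMid K n (exp (I * t)) := fun t => by
    rw [eq_laurentMid_add hn (hK _ (hsphere t))]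
    ring
  simp only [htail, sub_mul]
  rw [hsum, hint, trapezoidalError, intervalIntegral.integral_sub
    (intervalIntegrable_comp_exp_I_mul_mul hKc hw) (intervalIntegrable_comp_exp_I_mul_mul
      ((continuousOn_laurentMid K n).mono fun z hz => ne_zero_of_mem_unit_sphere ⟨z, hz⟩) hw)]
  ring

theorem isBigO_trapezoid_sub_circleInt_sub {u K : ℂ → ℂ} {w : ℝ → ℂ} {α ρ : ℝ} (hρ : 1 < ρ)
    (hK : AnalyticOnNhd ℂ K (annulus ρ)) (hw : ContinuousOn w (Set.Icc 0 (2 * Real.pi)))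
    (hwu : Set.EqOn w (fun t => u (exp (I * t))) (Set.Ioo 0 (2 * Real.pi))) (hα : 1 < α)
    (hdecay : (fun s : ℤ => fourierCoeffOn Real.two_pi_pos w s -
        (w (2 * Real.pi) - w 0) / (2 * Real.pi) * (I / s))
      =O[cofinite] fun s => |(s : ℝ)| ^ (-α)) :
    (fun n : ℕ => trapezoid (2 * n) (fun z => laurentMid K n z * u z) (laurentMid K n 1 * w 0)
        (laurentMid K n 1 * w (2 * Real.pi)) - circleInt (fun z => K z * u z) -
        (w (2 * Real.pi) - w 0) * I * correctionIntegral K n ρ)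
      =O[atTop] fun n => (n : ℝ) ^ (-α) := by
  obtain ⟨M, q, hq₀, hq₁, hc, hsum⟩ := exists_norm_laurentCoeff_le_and_hasSum hρ.le hK
  have hsphere : Metric.sphere 0 1 ⊆ annulus ρ := annulus_one ▸ annulus_mono one_pos hρ.le
  have hqn := isBigO_pow_rpow (-α) hq₀ hq₁
  have hρn := isBigO_pow_rpow (-α) (by positivity) (inv_lt_one_of_one_lt₀ hρ)
  have herror := isBigO_trapezoidalError_laurentMid_mul_sub hq₀.le hq₁ hc hw hα hdecay
  have htruncate := (isBigO_sum_midCoeff_mul_integral_sub hq₀.le hq₁ hc hρ.le).trans hρn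
  have htail := (isBigO_integral_laurentPlus_add_laurentMinus_mul hq₀.le hq₁ hc hw).trans hqn
  have hfolded := (isBigO_integral_foldedTail hq₀.le hq₁ hc hρ.le).trans hqn
  refine (((herror.add (htruncate.const_mul_left ((w (2 * Real.pi) - w 0) * I))).sub htail).sub
    (hfolded.const_mul_left ((w (2 * Real.pi) - w 0) * I))).congr' ?_ EventuallyEq.rfl
  filter_upwards [eventually_ne_atTop 0] with n hn
  rw [trapezoid_sub_circleInt (2 * n) hn (hK.continuousOn.mono hsphere)
    (fun z hz => hsum z (hsphere hz)) hw hwu, correctionIntegral]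
  ring

theorem intervalIntegrable_comp_exp_I_mul_mul_of_eqOn {u K : ℂ → ℂ} {w : ℝ → ℂ}
    (hK : ContinuousOn K (Metric.sphere 0 1)) (hw : ContinuousOn w (Set.Icc 0 (2 * Real.pi)))
    (hwu : Set.EqOn w (fun t => u (exp (I * t))) (Set.Ioo 0 (2 * Real.pi))) :
    IntervalIntegrable (fun t : ℝ => K (exp (I * t)) * u (exp (I * t))) volume 0
      (2 * Real.pi) := by
  refine (intervalIntegrable_comp_exp_I_mul_mul hK hw).congr_uIoo fun t ht => ?_
  rw [Set.uIoo_of_le Real.two_pi_pos.le] at ht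
  exact congrArg (K (exp (I * t)) * ·) (hwu ht)

theorem isPrincipalValue_correctionKernel_mul {K : ℂ → ℂ} {ρ : ℝ} (hρ : 1 < ρ)
    (hK : AnalyticOnNhd ℂ K (annulus ρ)) {n : ℕ} (hn : n ≠ 0) (a b : ℂ) :
    IsPrincipalValue (fun x : ℝ => correctionKernel K n x * (a - b) * (1 / (I * x))) ρ⁻¹ 1 ρ
      ((b - a) * I * correctionIntegral K n ρ) := by
  obtain ⟨M, q, hq₀, hq₁, hc, hsum⟩ := exists_norm_laurentCoeff_le_and_hasSum hρ.le hK
  convert (isPrincipalValue_correctionKernel hc hq₀.le hq₁ hn hρ hsum).const_mul ((b - a) * I)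
    using 2 with x
  rw [one_div, mul_inv, inv_I]
  ring

theorem exists_analyticOnNhd_annulus_le {K : ℂ → ℂ} {r : ℝ} (hr : 1 < r)
    (hK : AnalyticOnNhd ℂ K (Metric.sphere 0 1)) :
    ∃ ρ, 1 < ρ ∧ ρ ≤ r ∧ AnalyticOnNhd ℂ K (annulus ρ) := by
  obtain ⟨s, hs, hKs⟩ := exists_analyticOnNhd_annulus le_rfl (annulus_one ▸ hK)
  have hρ : 1 < min s r := lt_min hs hr
  exact ⟨min s r, hρ, min_le_right s r,
    hKs.mono (annulus_mono (zero_lt_one.trans hρ) (min_le_left s r))⟩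

theorem isBigO_sub_of_isLittleO_sub_cpow {f : ℂ → ℂ} {a C : ℂ} {β : ℝ} {l : Filter ℂ}
    (h : (fun t => f t - (a + C * t ^ (β : ℂ))) =o[l] fun t => ‖t‖ ^ β) :
    (fun t => f t - a) =O[l] fun t => ‖t‖ ^ β := by
  have hpow : (fun t : ℂ => C * t ^ (β : ℂ)) =O[l] fun t => ‖t‖ ^ β :=
    (IsBigO.of_norm_left (by simpa only [norm_cpow_real] using isBigO_refl _ l)).const_mul_left C
  exact (h.isBigO.add hpow).congr_left fun t => by ring

end ModifiedTrapezoid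

theorem mainTheorem3_general (u K : ℂ → ℂ) (r α κ : ℝ) (u₀ u₁ : ℂ)
    (hr : 1 < r) (hα : 1 < α) (hκ : 0 < κ)
    (hu : AnalyticOnNhd ℂ u (ModifiedTrapezoid.cutAnnulus r))
    (hu₀ : (fun t : ℂ => u (exp (I * t)) - u₀)
      =O[𝓝[ModifiedTrapezoid.sector κ] 0] (fun t : ℂ => ‖t‖ ^ (α - 1)))
    (hu₁ : (fun s : ℂ => u (exp (I * (2 * Real.pi - s))) - u₁)
      =O[𝓝[ModifiedTrapezoid.sector κ] 0] (fun s : ℂ => ‖s‖ ^ (α - 1)))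
    (hK : AnalyticOnNhd ℂ K (Metric.sphere 0 1)) :
    IntervalIntegrable (fun t : ℝ => K (exp (I * t)) * u (exp (I * t))) volume 0 (2 * Real.pi) ∧
    (∃ ρ : ℝ, 1 < ρ ∧ ρ ≤ r ∧ AnalyticOnNhd ℂ K (ModifiedTrapezoid.annulus ρ)) ∧
    ∀ ρ : ℝ, 1 < ρ → AnalyticOnNhd ℂ K (ModifiedTrapezoid.annulus ρ) →
      ∃ J : ℕ → ℂ,
        (∀ n : ℕ, 1 ≤ n → ModifiedTrapezoid.IsPrincipalValue
          (fun x : ℝ => ModifiedTrapezoid.correctionKernel K n x * (u₀ - u₁) * (1 / (I * x)))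
          ρ⁻¹ 1 ρ (J n)) ∧
        (fun n : ℕ =>
            ModifiedTrapezoid.trapezoid (2 * n)
                (fun z => ModifiedTrapezoid.laurentMid K n z * u z)
                (ModifiedTrapezoid.laurentMid K n 1 * u₀)
                (ModifiedTrapezoid.laurentMid K n 1 * u₁)
              - ModifiedTrapezoid.circleInt (fun z => K z * u z) - J n)
          =O[atTop] (fun n : ℕ => (n : ℝ) ^ (-α)) := by
  open ModifiedTrapezoid in
  have hf := differentiableOn_comp_exp_I_mul (by positivity) hu
  have hL := Real.log_pos hr
  obtain ⟨w, hw, rfl, rfl, hwu⟩ := exists_continuousOn_Icc_eqOn_Ioo hκ (sub_pos.2 hα)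
    Real.two_pi_pos (continuousOn_ofReal_of_differentiableOn_reProdIm hL hf) hu₀
    (by simpa using hu₁)
  refine ⟨intervalIntegrable_comp_exp_I_mul_mul_of_eqOn hK.continuousOn hw hwu,
    exists_analyticOnNhd_annulus_le hr hK, fun ρ hρ hKρ =>
    ⟨fun n => (w (2 * Real.pi) - w 0) * I * correctionIntegral K n ρ, fun n hn =>
      isPrincipalValue_correctionKernel_mul hρ hKρ (Nat.one_le_iff_ne_zero.1 hn) _ _, ?_⟩⟩
  exact isBigO_trapezoid_sub_circleInt_sub hρ hKρ hw hwu hα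
    (isBigO_fourierCoeffOn_sub_of_eqOn hκ hα.le hL hf hu₀ hu₁ hw hwu)

theorem mainTheorem3 (u K : ℂ → ℂ) (r α κ : ℝ) (u₀ u₁ C₃ C₄ : ℂ)
    (hr : 1 < r) (hα : 1 < α) (hκ : 0 < κ)
    (hu : AnalyticOnNhd ℂ u (ModifiedTrapezoid.cutAnnulus r))
    (hu₀ : (fun t : ℂ => u (exp (I * t)) - (u₀ + C₃ * t ^ ((α - 1 : ℝ) : ℂ)))
      =o[𝓝[ModifiedTrapezoid.sector κ] 0] (fun t : ℂ => ‖t‖ ^ (α - 1)))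
    (hu₁ : (fun s : ℂ => u (exp (I * (2 * Real.pi - s))) - (u₁ + C₄ * s ^ ((α - 1 : ℝ) : ℂ)))
      =o[𝓝[ModifiedTrapezoid.sector κ] 0] (fun s : ℂ => ‖s‖ ^ (α - 1)))
    (hK : AnalyticOnNhd ℂ K (Metric.sphere 0 1)) :
    IntervalIntegrable (fun t : ℝ => K (exp (I * t)) * u (exp (I * t))) volume 0 (2 * Real.pi) ∧
    (∃ ρ : ℝ, 1 < ρ ∧ ρ ≤ r ∧ AnalyticOnNhd ℂ K (ModifiedTrapezoid.annulus ρ)) ∧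
    ∀ ρ : ℝ, 1 < ρ → ρ ≤ r → AnalyticOnNhd ℂ K (ModifiedTrapezoid.annulus ρ) →
      ∃ J : ℕ → ℂ,
        (∀ n : ℕ, 1 ≤ n → ModifiedTrapezoid.IsPrincipalValue
          (fun x : ℝ => ModifiedTrapezoid.correctionKernel K n x * (u₀ - u₁) * (1 / (I * x)))
          ρ⁻¹ 1 ρ (J n)) ∧
        (fun n : ℕ =>
            ModifiedTrapezoid.trapezoid (2 * n)
                (fun z => ModifiedTrapezoid.laurentMid K n z * u z)
                (ModifiedTrapezoid.laurentMid K n 1 * u₀)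
                (ModifiedTrapezoid.laurentMid K n 1 * u₁)
              - ModifiedTrapezoid.circleInt (fun z => K z * u z) - J n)
          =O[atTop] (fun n : ℕ => (n : ℝ) ^ (-α)) :=
  have h := mainTheorem3_general u K r α κ u₀ u₁ hr hα hκ hu
    (ModifiedTrapezoid.isBigO_sub_of_isLittleO_sub_cpow hu₀)
    (ModifiedTrapezoid.isBigO_sub_of_isLittleO_sub_cpow hu₁) hK
  ⟨h.1, h.2.1, fun ρ hρ _ => h.2.2 ρ hρ⟩
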